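/- All CDGAs are commutative differential graded algebras over $\mathbb{Q}$, graded in non-negative degrees, with differential of degree $+1$. A CDGA $A$ is connected if $A^0=\mathbb{Q}$, it is $1$-connected if moreover $A^1=0$, and it is of finite type if each $A^p$ is finite-dimensional. For an integer $n\ge 0$, let $s^{-n}\#A$ be the $A$-dgmodule whose component in degree $p$ is $\operatorname{Hom}(A^{n-p},\mathbb{Q})$. A Poincaré duality CDGA in dimension $n$ is a connected CDGA $P$ of finite type for which there is an isomorphism of $P$-dgmodules $P\cong s^{-n}\#P$; a Poincaré duality algebra in dimension $n$ is such a CDGA with zero differential. Let $n\ge 7$, and let $A$ be a $1$-connected CDGA of finite type such that $A^2\subset\ker d$ and such that the cohomology algebra $\operatorname{H}(A)$ is a Poincaré duality algebra in dimension $n$. Then there exist a Poincaré duality CDGA $P$ in dimension $n$ and a morphism of CDGAs $\lambda\colon A\to P$ which is a quasi-isomorphism (it induces an isomorphism in cohomology) and which is an isomorphism $A^p\cong P^p$ in every degree $p<\frac n2-1$. -/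

import Mathlib

universe u

/-- A commutative differential graded algebra over `ℚ`, graded by the non-negative integers:
a graded algebra `⨁ p, deg p` with a differential `d` of degree `+1` which is a derivation
in the graded sense, and whose product is commutative in the graded sense. -/
structure CDGA where
  /-- The total algebra. -/
  carrier : Type u
  [ring : Ring carrier]
  [algebra : Algebra ℚ carrier]
  /-- The homogeneous component in each degree. -/
  deg : ℕ → Submodule ℚ carrier
  [graded : GradedAlgebra deg]
  /-- The differential. -/
  d : carrier →ₗ[ℚ] carrier
  d_mem : ∀ (p : ℕ) (a : carrier), a ∈ deg p → d a ∈ deg (p + 1)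
  d_d : ∀ a : carrier, d (d a) = 0
  leibniz : ∀ (p : ℕ) (a b : carrier), a ∈ deg p →
    d (a * b) = d a * b + (-1 : ℚ) ^ p • (a * d b)
  graded_comm : ∀ (p q : ℕ) (a b : carrier), a ∈ deg p → b ∈ deg q →
    a * b = (-1 : ℚ) ^ (p * q) • (b * a)

/-- A two-sided homogeneous ideal `I` of a graded algebra induces a grading on the quotient. -/
@[reducible]
noncomputable def quotientGrading {R : Type u} [Ring R] [Algebra ℚ R] (𝒜 : ℕ → Submodule ℚ R)
    [GradedAlgebra 𝒜] (I : Ideal R) [I.IsTwoSided]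
    (hI : ∀ (p : ℕ) (x : R), x ∈ I → (DirectSum.decompose 𝒜 x p : R) ∈ I) :
    GradedAlgebra (fun p => (𝒜 p).map (Ideal.Quotient.mkₐ ℚ I).toLinearMap) :=
  have gm : SetLike.GradedMonoid
      (fun p => (𝒜 p).map (Ideal.Quotient.mkₐ ℚ I).toLinearMap) :=
    { one_mem := ⟨1, SetLike.GradedOne.one_mem, map_one (Ideal.Quotient.mkₐ ℚ I)⟩
      mul_mem := by
        rintro p q _ _ ⟨a, ha, rfl⟩ ⟨b, hb, rfl⟩
        exact ⟨a * b, SetLike.GradedMul.mul_mem ha hb, map_mul (Ideal.Quotient.mkₐ ℚ I) a b⟩ }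
  have int : DirectSum.IsInternal
      (fun p => (𝒜 p).map (Ideal.Quotient.mkₐ ℚ I).toLinearMap) := by
    classical
    constructor
    · rw [injective_iff_map_eq_zero]
      intro v hv
      have hlift : ∀ p, ∃ z : R, z ∈ 𝒜 p ∧ Ideal.Quotient.mkₐ ℚ I z = (v p : R ⧸ I) := by
        intro p
        obtain ⟨z, hz, e⟩ := (v p).2
        exact ⟨z, hz, e⟩
      choose z hz hzv using hlift
      rw [DirectSum.coeAddMonoidHom_eq_dfinsuppSum, DFinsupp.sum] at hv
      have hsum : (∑ p ∈ DFinsupp.support v, z p) ∈ I := by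
        rw [← Ideal.Quotient.eq_zero_iff_mem, ← Ideal.Quotient.mkₐ_eq_mk ℚ, map_sum, ← hv]
        exact Finset.sum_congr rfl fun p _ => hzv p
      ext p
      by_cases hp : p ∈ DFinsupp.support v
      · have := hI p _ hsum
        rw [DirectSum.decompose_sum, DFinsupp.finsetSum_apply, AddSubmonoidClass.coe_finsetSum,
          Finset.sum_eq_single p] at this
        · rw [DirectSum.decompose_of_mem_same 𝒜 (hz p), ← Ideal.Quotient.eq_zero_iff_mem,
            ← Ideal.Quotient.mkₐ_eq_mk ℚ, hzv] at this
          simpa using this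
        · intro q _ hqp
          exact DirectSum.decompose_of_mem_ne 𝒜 (hz q) hqp
        · exact fun h => absurd hp h
      · simpa using hp
    · intro y
      obtain ⟨x, rfl⟩ := Ideal.Quotient.mkₐ_surjective ℚ I y
      refine ⟨∑ p ∈ (DirectSum.decompose 𝒜 x).support, DirectSum.of
        (fun p => (𝒜 p).map (Ideal.Quotient.mkₐ ℚ I).toLinearMap) p
        ⟨Ideal.Quotient.mkₐ ℚ I (DirectSum.decompose 𝒜 x p : R),
          ⟨_, (DirectSum.decompose 𝒜 x p).2, rfl⟩⟩, ?_⟩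
      rw [map_sum]
      simp only [DirectSum.coeAddMonoidHom_of]
      rw [← map_sum, DirectSum.sum_support_decompose]
  { gm with toDecomposition := int.chooseDecomposition }

/-- A homogeneous subalgebra `Z` of a graded algebra inherits a grading. -/
@[reducible]
noncomputable def subalgebraGrading {R : Type u} [Ring R] [Algebra ℚ R] (𝒜 : ℕ → Submodule ℚ R)
    [GradedAlgebra 𝒜] (Z : Subalgebra ℚ R)
    (hZ : ∀ (p : ℕ) (x : R), x ∈ Z → (DirectSum.decompose 𝒜 x p : R) ∈ Z) :
    GradedAlgebra (fun p => (𝒜 p).comap Z.val.toLinearMap) :=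
  have gm : SetLike.GradedMonoid (fun p => (𝒜 p).comap Z.val.toLinearMap) :=
    { one_mem := show (1 : R) ∈ 𝒜 0 from SetLike.GradedOne.one_mem
      mul_mem := fun p q a b ha hb =>
        show (a : R) * (b : R) ∈ 𝒜 (p + q) from SetLike.GradedMul.mul_mem ha hb }
  have int : DirectSum.IsInternal (fun p => (𝒜 p).comap Z.val.toLinearMap) := by
    classical
    constructor
    · rw [injective_iff_map_eq_zero]
      intro v hv
      have hv' := congrArg (fun z : Z => (z : R)) hv
      rw [DirectSum.coeAddMonoidHom_eq_dfinsuppSum, DFinsupp.sum] at hv'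
      simp only [AddSubmonoidClass.coe_finsetSum, ZeroMemClass.coe_zero] at hv'
      ext p
      by_cases hp : p ∈ DFinsupp.support v
      · have := congrArg (fun x => (DirectSum.decompose 𝒜 x p : R)) hv'
        simp only at this
        rw [DirectSum.decompose_sum, DFinsupp.finsetSum_apply, AddSubmonoidClass.coe_finsetSum,
          Finset.sum_eq_single p] at this
        · rw [DirectSum.decompose_of_mem_same 𝒜
            (show ((v p : Z) : R) ∈ 𝒜 p from (v p).2)] at this
          simpa using this
        · intro q _ hqp
          exact DirectSum.decompose_of_mem_ne 𝒜 (v q).2 hqp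
        · exact fun h => absurd hp h
      · have : v p = 0 := by simpa using hp
        simp [this]
    · intro x
      refine ⟨∑ p ∈ (DirectSum.decompose 𝒜 (x : R)).support, DirectSum.of
        (fun p => (𝒜 p).comap Z.val.toLinearMap) p
        ⟨⟨(DirectSum.decompose 𝒜 (x : R) p : R), hZ p x x.2⟩,
          (DirectSum.decompose 𝒜 (x : R) p).2⟩, ?_⟩
      rw [map_sum]
      simp only [DirectSum.coeAddMonoidHom_of]
      apply Subtype.ext
      simp only [AddSubmonoidClass.coe_finsetSum]
      exact DirectSum.sum_support_decompose 𝒜 (x : R)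
  { gm with toDecomposition := int.chooseDecomposition }

namespace CDGA

instance : CoeSort CDGA.{u} (Type u) := ⟨CDGA.carrier⟩

instance (A : CDGA.{u}) : Ring A := A.ring

instance (A : CDGA.{u}) : Algebra ℚ A := A.algebra

instance (A : CDGA.{u}) : GradedAlgebra A.deg := A.graded

variable (A : CDGA.{u})

theorem decompose_d_succ (p : ℕ) (a : A) :
    (DirectSum.decompose A.deg (A.d a) (p + 1) : A) = A.d (DirectSum.decompose A.deg a p : A) := by
  classical
  induction a using DirectSum.Decomposition.inductionOn A.deg with
  | zero => simp
  | @homogeneous i m =>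
    by_cases h : i = p
    · subst h
      rw [DirectSum.decompose_of_mem_same _ (A.d_mem i m m.2),
        DirectSum.decompose_of_mem_same _ m.2]
    · rw [DirectSum.decompose_of_mem_ne _ (A.d_mem i m m.2) (by omega),
        DirectSum.decompose_of_mem_ne _ m.2 h, map_zero]
  | add a b ha hb => simp [ha, hb]

theorem decompose_d_zero (a : A) :
    (DirectSum.decompose A.deg (A.d a) 0 : A) = 0 := by
  classical
  induction a using DirectSum.Decomposition.inductionOn A.deg with
  | zero => simp
  | @homogeneous i m =>
    rw [DirectSum.decompose_of_mem_ne _ (A.d_mem i m m.2) (by omega)]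
  | add a b ha hb => simp [ha, hb]

theorem d_mul_of_cocycle (a b : A) (hb : A.d b = 0) : A.d (a * b) = A.d a * b := by
  classical
  induction a using DirectSum.Decomposition.inductionOn A.deg with
  | zero => simp
  | @homogeneous i m => rw [A.leibniz i m b m.2, hb]; simp
  | add a a' h h' => rw [add_mul, map_add, map_add, h, h', add_mul]

theorem d_one : A.d 1 = 0 := by
  have h := A.leibniz 0 1 1 SetLike.GradedOne.one_mem
  simpa using h

theorem cocycle_mul_d (a b : A) (ha : A.d a = 0) : ∃ c : A, a * A.d b = A.d c := by
  classical
  suffices h : a * A.d b ∈ LinearMap.range A.d by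
    obtain ⟨c, hc⟩ := h
    exact ⟨c, hc.symm⟩
  rw [← DirectSum.sum_support_decompose A.deg a, Finset.sum_mul]
  refine Submodule.sum_mem _ fun p _ => ?_
  have h0 : A.d (DirectSum.decompose A.deg a p : A) = 0 := by
    rw [← decompose_d_succ, ha]; simp
  refine ⟨(-1 : ℚ) ^ p • ((DirectSum.decompose A.deg a p : A) * b), ?_⟩
  rw [map_smul, A.leibniz p _ b (DirectSum.decompose A.deg a p).2, h0, zero_mul, zero_add,
    smul_smul, ← mul_pow]
  simp

/-- The algebra `ker d` of cocycles. -/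
def cocycles : Subalgebra ℚ A where
  carrier := {a | A.d a = 0}
  mul_mem' := by
    intro a b ha hb
    change A.d (a * b) = 0
    rw [A.d_mul_of_cocycle a b hb, show A.d a = 0 from ha, zero_mul]
  add_mem' := by
    intro a b ha hb
    change A.d (a + b) = 0
    rw [map_add, show A.d a = 0 from ha, show A.d b = 0 from hb, add_zero]
  algebraMap_mem' := by
    intro r
    change A.d (algebraMap ℚ A r) = 0
    rw [Algebra.algebraMap_eq_smul_one, map_smul, A.d_one, smul_zero]

/-- The ideal `im d` of coboundaries in the algebra of cocycles. -/
def coboundaries : Ideal A.cocycles where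
  carrier := {z | ∃ a : A, (z : A) = A.d a}
  add_mem' := by
    rintro z w ⟨a, ha⟩ ⟨b, hb⟩
    exact ⟨a + b, by rw [map_add, ← ha, ← hb]; rfl⟩
  zero_mem' := ⟨0, by simp⟩
  smul_mem' := by
    rintro z w ⟨a, ha⟩
    obtain ⟨c, hc⟩ := A.cocycle_mul_d z a z.2
    exact ⟨c, by rw [← hc, ← ha]; rfl⟩

instance : A.coboundaries.IsTwoSided where
  mul_mem_of_left := by
    rintro z w ⟨a, ha⟩
    exact ⟨a * w, by rw [A.d_mul_of_cocycle a w w.2, ← ha]; rfl⟩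

/-- The homogeneous components of the algebra of cocycles. -/
def cocycleDeg (p : ℕ) : Submodule ℚ A.cocycles :=
  (A.deg p).comap A.cocycles.val.toLinearMap

/-- The grading of the algebra of cocycles. -/
noncomputable instance cocyclesGrading :
    GradedAlgebra A.cocycleDeg :=
  subalgebraGrading A.deg A.cocycles (by
    intro p x hx
    change A.d _ = 0
    rw [← decompose_d_succ, show A.d x = 0 from hx]
    simp)

theorem coe_decompose_cocycles (p : ℕ) (z : A.cocycles) :
    ((DirectSum.decompose A.cocycleDeg z p :
      A.cocycles) : A) = DirectSum.decompose A.deg (z : A) p := by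
  classical
  induction z using DirectSum.Decomposition.inductionOn A.cocycleDeg with
  | zero => simp
  | @homogeneous i m =>
    by_cases h : i = p
    · subst h
      have hm : ((m : A.cocycles) : A) ∈ A.deg i := m.2
      rw [DirectSum.decompose_of_mem_same _ m.2, DirectSum.decompose_of_mem_same A.deg hm]
    · have hm : ((m : A.cocycles) : A) ∈ A.deg i := m.2
      rw [DirectSum.decompose_of_mem_ne _ m.2 h, DirectSum.decompose_of_mem_ne A.deg hm h]
      rfl
  | add a b ha hb => simp [ha, hb]

/-- The homogeneous components of `ker d / im d`: a class has degree `p` if it is represented by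
a cocycle of degree `p`. -/
noncomputable def cohomologyDeg (p : ℕ) : Submodule ℚ (A.cocycles ⧸ A.coboundaries) :=
  (A.cocycleDeg p).map (Ideal.Quotient.mkₐ ℚ A.coboundaries).toLinearMap

/-- The grading of the cohomology algebra `ker d / im d`. -/
noncomputable instance cohomologyGrading :
    GradedAlgebra A.cohomologyDeg :=
  quotientGrading A.cocycleDeg A.coboundaries (by
    rintro p z ⟨a, ha⟩
    change ∃ b : A, _ = A.d b
    rw [coe_decompose_cocycles, ha]
    cases p with
    | zero => exact ⟨0, by rw [decompose_d_zero, map_zero]⟩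
    | succ p => exact ⟨_, decompose_d_succ A p a⟩)

/-- The cohomology algebra `H(A) = ker d / im d`, as a CDGA with zero differential. -/
noncomputable def cohomology : CDGA.{u} where
  carrier := A.cocycles ⧸ A.coboundaries
  deg := A.cohomologyDeg
  d := 0
  d_mem := fun _ _ _ => Submodule.zero_mem _
  d_d := fun _ => rfl
  leibniz := by intros; simp
  graded_comm := by
    rintro p q _ _ ⟨a, ha, rfl⟩ ⟨b, hb, rfl⟩
    have h : a * b = (-1 : ℚ) ^ (p * q) • (b * a) :=
      Subtype.ext (A.graded_comm p q a b ha hb)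
    have h' := congrArg (Ideal.Quotient.mkₐ ℚ A.coboundaries) h
    rw [map_mul, map_smul, map_mul] at h'
    exact h'

/-- A CDGA is connected if its component of degree `0` is `ℚ` (embedded by the unit). -/
def IsConnected : Prop :=
  Function.Injective (algebraMap ℚ A) ∧ ∀ a ∈ A.deg 0, ∃ r : ℚ, algebraMap ℚ A r = a

/-- A CDGA is `1`-connected if it is connected and zero in degree `1`. -/
def IsOneConnected : Prop :=
  A.IsConnected ∧ A.deg 1 = ⊥

/-- A CDGA is of finite type if it is finite-dimensional in every degree. -/
def IsFiniteType : Prop :=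
  ∀ p : ℕ, FiniteDimensional ℚ (A.deg p)

/-- The component of degree `p` of the suspended dual `s⁻ⁿ#A`, that is `Hom(Aⁿ⁻ᵖ, ℚ)` (zero for
`p > n`), realized as the space of the functionals on `A` that vanish on `A^q` for
all `q ≠ n - p`. -/
def suspendedDual (n p : ℕ) : Submodule ℚ (Module.Dual ℚ A) where
  carrier := {f | ∀ q : ℕ, q + p ≠ n → ∀ x ∈ A.deg q, f x = 0}
  add_mem' := by
    intro f g hf hg q hq x hx
    rw [LinearMap.add_apply, hf q hq x hx, hg q hq x hx, add_zero]
  zero_mem' := fun _ _ _ _ => rfl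
  smul_mem' := by
    intro c f hf q hq x hx
    rw [LinearMap.smul_apply, hf q hq x hx, smul_zero]

/-- The action of `A` on functionals, `(a • f)(x) = f(x a)`. -/
def dualAction (a : A) : Module.Dual ℚ A →ₗ[ℚ] Module.Dual ℚ A :=
  LinearMap.lcomp ℚ ℚ (LinearMap.mulRight ℚ a)

/-- The differential of `s⁻ⁿ#A` on the component of degree `p`, namely
`δ f = (-1)ⁿ⁺ᵖ f ∘ d`. With this sign `δ` is a graded derivation over `A`. -/
def dualDifferential (n p : ℕ) : Module.Dual ℚ A →ₗ[ℚ] Module.Dual ℚ A :=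
  (-1 : ℚ) ^ (n + p) • LinearMap.lcomp ℚ ℚ A.d

/-- An isomorphism of `A`-dgmodules `θ : A ≅ s⁻ⁿ#A`. -/
structure PoincareIso (n : ℕ) where
  /-- The underlying linear map. -/
  θ : A →ₗ[ℚ] Module.Dual ℚ A
  /-- `θ` is an isomorphism in each degree. -/
  bijOn : ∀ p : ℕ, Set.BijOn θ (A.deg p) (A.suspendedDual n p)
  /-- `θ` is a morphism of `A`-modules. -/
  map_mul : ∀ a b : A, θ (a * b) = A.dualAction a (θ b)
  /-- `θ` commutes with the differentials. -/
  map_d : ∀ (p : ℕ) (a : A), a ∈ A.deg p → θ (A.d a) = A.dualDifferential n p (θ a)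

/-- A Poincaré duality CDGA in dimension `n`: a connected CDGA of finite type which is isomorphic
to `s⁻ⁿ#A` as an `A`-dgmodule. A Poincaré duality algebra is the case of a zero differential. -/
def IsPoincareDuality (n : ℕ) : Prop :=
  A.IsConnected ∧ A.IsFiniteType ∧ Nonempty (A.PoincareIso n)

/-- A morphism of CDGAs: a morphism of algebras which preserves degrees and commutes with
the differentials. -/
structure Hom (A B : CDGA.{u}) where
  /-- The underlying morphism of algebras. -/
  toAlgHom : A →ₐ[ℚ] B
  map_deg : ∀ (p : ℕ) (a : A), a ∈ A.deg p → toAlgHom a ∈ B.deg p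
  map_d : ∀ a : A, toAlgHom (A.d a) = B.d (toAlgHom a)

namespace Hom

variable {A B : CDGA.{u}} (f : Hom A B)

/-- The restriction of a morphism of CDGAs to cocycles. -/
def mapCocycles : A.cocycles →ₐ[ℚ] B.cocycles :=
  (f.toAlgHom.comp A.cocycles.val).codRestrict B.cocycles (by
    intro z
    change B.d (f.toAlgHom z) = 0
    rw [← f.map_d, show A.d z = 0 from z.2, _root_.map_zero])

/-- The morphism induced in cohomology by a morphism of CDGAs. -/
noncomputable def mapCohomology : A.cohomology →ₐ[ℚ] B.cohomology :=
  Ideal.Quotient.liftₐ A.coboundaries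
    ((Ideal.Quotient.mkₐ ℚ B.coboundaries).comp f.mapCocycles) (by
      rintro z ⟨a, ha⟩
      change Ideal.Quotient.mk B.coboundaries (f.mapCocycles z) = 0
      rw [Ideal.Quotient.eq_zero_iff_mem]
      refine ⟨f.toAlgHom a, ?_⟩
      rw [← f.map_d, ← ha]
      rfl)

/-- A quasi-isomorphism is a morphism that induces an isomorphism in cohomology. -/
def IsQuasiIso : Prop :=
  Function.Bijective f.mapCohomology

/-- A morphism is an isomorphism in degree `p` if it maps `A^p` bijectively onto `B^p`. -/
def IsIsoInDegree (p : ℕ) : Prop :=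
  Set.BijOn f.toAlgHom (A.deg p) (B.deg p)

end Hom

end CDGA

/-! The orientation of `H(A)` is induced by a functional `ε` of degree `n` on `A` that kills
coboundaries (`exists_orientation`). Dividing `A` by the radical of the pairing `ε(xy)` would give a
nondegenerate pairing, but might create cohomology and kill elements of low degree.

So `A` is first enlarged to the square-zero extension `B = A ⊕ s⁻ⁿ#(A/N)`, for a differential ideal
`N`, and `ε` is extended by evaluation at `1`. The new summand detects every element of `A` outside
`N`: a pair `(a, f)` in the radical has `a ∈ N` and `f = -ε(· a)`. The model `P` is `B` modulo this
radical.

The ideal (`exists_complementary`) is zero below `n/2`, everything above `n/2 + 1`, and a complement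
of the coboundaries in between. Then `A/N` has no cohomology in degrees `≥ n/2`, so by
`exists_dualD_eq` its suspended dual has none in degrees `≤ n/2`; moreover that dual vanishes in
degrees `< n/2 - 1`. Hence `A → P` is bijective in those degrees and surjective in cohomology up to
`n/2`. Poincaré duality on both sides gives the rest (`isQuasiIso_of_surjective_below`). -/

theorem LinearMap.exists_eq_comp_of_ker_le {K V W : Type*} [Field K] [AddCommGroup V] [Module K V]
    [AddCommGroup W] [Module K W] (g : V →ₗ[K] W) (f : V →ₗ[K] K)
    (h : ∀ x, g x = 0 → f x = 0) : ∃ φ : W →ₗ[K] K, ∀ x, φ (g x) = f x := by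
  have hf : f ∈ LinearMap.range g.dualMap := by
    rw [LinearMap.range_dualMap_eq_dualAnnihilator_ker, Submodule.mem_dualAnnihilator]
    exact fun x hx => h x hx
  obtain ⟨φ, hφ⟩ := hf
  exact ⟨φ, fun x => LinearMap.congr_fun hφ x⟩

/-- The linear map induced on the quotient by an ideal. -/
def Ideal.quotientLiftLinear {R M : Type*} [Ring R] [Algebra ℚ R] [AddCommGroup M] [Module ℚ M]
    (I : Ideal R) [I.IsTwoSided] (f : R →ₗ[ℚ] M) (h : ∀ x ∈ I, f x = 0) : R ⧸ I →ₗ[ℚ] M :=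
  (Submodule.liftQ (I.restrictScalars ℚ) f h) ∘ₗ
    (Submodule.Quotient.restrictScalarsEquiv ℚ I).symm.toLinearMap

namespace CDGA

/-! ### Functionals of fixed degree, sign twists, and the orientation `θ 1`. -/

section Basic

variable (A : CDGA.{u})

theorem ext_dual {f g : Module.Dual ℚ A} (h : ∀ p, ∀ x ∈ A.deg p, f x = g x) : f = g := by
  ext x
  induction x using DirectSum.Decomposition.inductionOn A.deg with
  | zero => simp
  | @homogeneous i m => exact h i m m.2
  | add a b ha hb => rw [map_add, map_add, ha, hb]

/-- The algebra endomorphism that multiplies the elements of degree `p` by `c ^ p`. -/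
noncomputable def scale (c : ℚ) : A →ₐ[ℚ] A :=
  (DirectSum.toAlgebra ℚ (fun p => A.deg p) (fun p => c ^ p • (A.deg p).subtype)
    (by change c ^ 0 • (1 : A) = 1; simp)
    (by
      intro i j a b
      change c ^ (i + j) • ((a : A) * (b : A)) = (c ^ i • (a : A)) * (c ^ j • (b : A))
      rw [smul_mul_smul_comm, pow_add])).comp
    (DirectSum.decomposeAlgEquiv A.deg).toAlgHom

variable {A}

theorem scale_of_mem (c : ℚ) {p : ℕ} {a : A} (ha : a ∈ A.deg p) : A.scale c a = c ^ p • a := by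
  have h : A.scale c a = DirectSum.toModule ℚ ℕ A (fun p => c ^ p • (A.deg p).subtype)
    (DirectSum.decompose A.deg a) := rfl
  rw [h, DirectSum.decompose_of_mem _ ha]
  exact DirectSum.toModule_lof (M := fun p => A.deg p) ℚ p ⟨a, ha⟩

theorem apply_eq_apply_decompose {n p q : ℕ} {f : Module.Dual ℚ A} (hf : f ∈ A.suspendedDual n p)
    (h : q + p = n) (x : A) : f x = f (DirectSum.decompose A.deg x q : A) := by
  induction x using DirectSum.Decomposition.inductionOn A.deg with
  | zero => simp
  | @homogeneous i m =>
    by_cases hi : i = q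
    · subst hi
      rw [DirectSum.decompose_of_mem_same _ m.2]
    · rw [DirectSum.decompose_of_mem_ne _ m.2 hi, hf i (by omega) m m.2, map_zero]
  | add a b ha hb => simp [ha, hb]

theorem eq_zero_of_mem_suspendedDual {n p : ℕ} (h : n < p) {f : Module.Dual ℚ A}
    (hf : f ∈ A.suspendedDual n p) : f = 0 :=
  A.ext_dual fun q x hx => hf q (by omega) x hx

theorem comp_proj_mem_suspendedDual {n p q : ℕ} (h : q + p = n) (f : Module.Dual ℚ A) :
    f ∘ₗ GradedAlgebra.proj A.deg q ∈ A.suspendedDual n p := by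
  intro i hi x hx
  rw [LinearMap.comp_apply, GradedAlgebra.proj_apply,
    DirectSum.decompose_of_mem_ne _ hx (by omega), map_zero]

theorem finiteDimensional_suspendedDual (hA : A.IsFiniteType) (n p : ℕ) :
    FiniteDimensional ℚ (A.suspendedDual n p) := by
  rcases Nat.lt_or_ge n p with h | h
  · have : A.suspendedDual n p = ⊥ :=
      (Submodule.eq_bot_iff _).2 fun f hf => eq_zero_of_mem_suspendedDual h hf
    rw [this]
    infer_instance
  · have := hA (n - p)
    let r : A.suspendedDual n p →ₗ[ℚ] Module.Dual ℚ (A.deg (n - p)) :=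
      (A.deg (n - p)).subtype.dualMap ∘ₗ (A.suspendedDual n p).subtype
    refine FiniteDimensional.of_injective r ?_
    rw [injective_iff_map_eq_zero]
    intro f hf
    apply Subtype.ext
    refine A.ext_dual fun q x hx => ?_
    by_cases hq : q + p = n
    · obtain rfl : q = n - p := by omega
      exact LinearMap.congr_fun hf ⟨x, hx⟩
    · exact f.2 q hq x hx

/-- By linearity over `A`, a duality isomorphism is determined by its orientation `θ 1`, and from
here on it is used only as the pairing `(x, a) ↦ θ 1 (x a)`. -/
theorem PoincareIso.apply_eq {n : ℕ} (I : A.PoincareIso n) (a x : A) :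
    I.θ a x = I.θ 1 (x * a) := by
  have := I.map_mul a 1
  rw [mul_one] at this
  rw [this]
  rfl

theorem PoincareIso.one_mem {n : ℕ} (I : A.PoincareIso n) : I.θ 1 ∈ A.suspendedDual n 0 :=
  (I.bijOn 0).mapsTo SetLike.GradedOne.one_mem

theorem PoincareIso.apply_one_d {n : ℕ} (I : A.PoincareIso n) (a : A) : I.θ 1 (A.d a) = 0 := by
  have h := I.map_d 0 1 SetLike.GradedOne.one_mem
  rw [A.d_one, map_zero] at h
  have h' := LinearMap.congr_fun h a
  change 0 = (-1 : ℚ) ^ (n + 0) • I.θ 1 (A.d a) at h'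
  simpa using h'.symm

theorem PoincareIso.eq_zero_of_lt {n p : ℕ} (I : A.PoincareIso n) (h : n < p) {a : A}
    (ha : a ∈ A.deg p) : a = 0 := by
  refine (I.bijOn p).injOn ha (Submodule.zero_mem _) ?_
  rw [map_zero]
  exact eq_zero_of_mem_suspendedDual h ((I.bijOn p).mapsTo ha)

end Basic

/-! ### From a nondegenerate pairing to a duality isomorphism. -/

section Nondegenerate

variable {P : CDGA.{u}} {n : ℕ} {ε : Module.Dual ℚ P}

/-- A nondegenerate functional of degree `n` which vanishes on coboundaries defines an isomorphism
with the suspended dual. -/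
noncomputable def PoincareIso.ofNondegenerate (hft : P.IsFiniteType)
    (hε : ε ∈ P.suspendedDual n 0) (hεd : ∀ x, ε (P.d x) = 0)
    (hnd : ∀ x, (∀ y, ε (y * x) = 0) → x = 0) : P.PoincareIso n where
  θ := (LinearMap.mul ℚ P).flip.compr₂ ε
  bijOn := by
    have hpair : ∀ p q : ℕ, p + q ≠ n → ∀ x ∈ P.deg p, ∀ y ∈ P.deg q, ε (x * y) = 0 :=
      fun p q hpq x hx y hy => hε (p + q) (by omega) _ (SetLike.GradedMul.mul_mem hx hy)
    -- Only complementary degrees pair nontrivially, so nondegeneracy can be tested degree by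
    -- degree.
    have hnd' : ∀ p q : ℕ, q + p = n → ∀ x ∈ P.deg p, (∀ y ∈ P.deg q, ε (y * x) = 0) → x = 0 := by
      intro p q hpq x hx h
      apply hnd
      refine LinearMap.congr_fun (f := ε ∘ₗ LinearMap.mulRight ℚ x) (g := 0)
        (P.ext_dual fun r y hy => ?_)
      by_cases hr : r = q
      · subst hr
        exact h y hy
      · exact hpair r p (by omega) y hy x hx
    intro p
    refine ⟨fun a ha q hq x hx => hpair q p hq x hx a ha, fun a _ b _ hab => ?_, fun φ hφ => ?_⟩
    · refine sub_eq_zero.1 (hnd _ fun y => ?_)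
      have := LinearMap.congr_fun hab y
      change ε (y * a) = ε (y * b) at this
      rw [mul_sub, map_sub, this, sub_self]
    · rcases Nat.lt_or_ge n p with h | h
      · exact ⟨0, Submodule.zero_mem _, by
          rw [map_zero, eq_zero_of_mem_suspendedDual h hφ]⟩
      · obtain ⟨q, hq⟩ : ∃ q, q + p = n := ⟨n - p, by omega⟩
        -- Used for `(p, q)` and for `(q, p)`: the two injections force equal finite dimensions, so
        -- each of them is onto.
        have key : ∀ p q : ℕ, q + p = n → ∃ g : P.deg p →ₗ[ℚ] Module.Dual ℚ (P.deg q),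
            Function.Injective g ∧ ∀ a x, g a x = ε ((x : P) * (a : P)) := by
          intro p q hq
          refine ⟨((LinearMap.mul ℚ P).flip.compr₂ ε).domRestrict₁₂ (P.deg p) (P.deg q), ?_,
            fun a x => rfl⟩
          rw [injective_iff_map_eq_zero]
          intro a ha
          exact Subtype.ext (hnd' p q hq a a.2 fun y hy => LinearMap.congr_fun ha ⟨y, hy⟩)
        obtain ⟨g, hg, hgε⟩ := key p q hq
        obtain ⟨g', hg', -⟩ := key q p (by omega)
        have := hft p
        have := hft q
        have e : Module.finrank ℚ (P.deg p) = Module.finrank ℚ (Module.Dual ℚ (P.deg q)) := by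
          have h1 := LinearMap.finrank_le_finrank_of_injective hg
          have h2 := LinearMap.finrank_le_finrank_of_injective hg'
          rw [Subspace.dual_finrank_eq] at h1 h2 ⊢
          exact le_antisymm h1 h2
        obtain ⟨a, ha⟩ := (LinearMap.injective_iff_surjective_of_finrank_eq_finrank e).1 hg
          (φ ∘ₗ (P.deg q).subtype)
        refine ⟨a, a.2, P.ext_dual fun r x hx => ?_⟩
        by_cases hr : r = q
        · subst hr
          exact (hgε a ⟨x, hx⟩).symm.trans (LinearMap.congr_fun ha ⟨x, hx⟩)
        · rw [hφ r (by omega) x hx]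
          exact hpair r p (by omega) x hx a a.2
  map_mul := by
    intro a b
    ext x
    change ε (x * (a * b)) = ε (x * a * b)
    rw [mul_assoc]
  map_d := by
    intro p a ha
    refine P.ext_dual fun q x hx => ?_
    change ε (x * P.d a) = (-1 : ℚ) ^ (n + p) • ε (P.d x * a)
    by_cases hq : q + (p + 1) = n
    · have h := hεd (x * a)
      rw [P.leibniz q x a hx, map_add, map_smul] at h
      rw [eq_neg_of_add_eq_zero_left h, ← hq]
      have : -((-1 : ℚ) ^ (q + (p + 1) + p) * (-1) ^ q) = 1 := by
        rw [← pow_add, show q + (p + 1) + p + q = 2 * (p + q) + 1 by ring, pow_succ, pow_mul]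
        simp
      simp only [smul_eq_mul] at *
      linear_combination (-ε (x * P.d a)) * this
    · rw [hε (q + (p + 1)) (by omega) _ (SetLike.GradedMul.mul_mem hx (P.d_mem p a ha)),
        hε (q + 1 + p) (by omega) _ (SetLike.GradedMul.mul_mem (P.d_mem q x hx) ha), smul_zero]

@[simp]
theorem PoincareIso.ofNondegenerate_apply (hft : P.IsFiniteType)
    (hε : ε ∈ P.suspendedDual n 0) (hεd : ∀ x, ε (P.d x) = 0)
    (hnd : ∀ x, (∀ y, ε (y * x) = 0) → x = 0) (a x : P) :
    (PoincareIso.ofNondegenerate hft hε hεd hnd).θ a x = ε (x * a) := rfl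

end Nondegenerate

/-! ### Quotients of CDGAs, and the quotient by the radical of a functional. -/

section Quotient

variable (B : CDGA.{u}) (I : Ideal B) [I.IsTwoSided]

/-- The quotient of a CDGA by a homogeneous differential ideal. -/
noncomputable def quotient (hI : ∀ (p : ℕ) (x : B), x ∈ I → (DirectSum.decompose B.deg x p : B) ∈ I)
    (hd : ∀ x ∈ I, B.d x ∈ I) : CDGA.{u} where
  carrier := B ⧸ I
  deg := fun p => (B.deg p).map (Ideal.Quotient.mkₐ ℚ I).toLinearMap
  graded := quotientGrading B.deg I hI
  d := I.quotientLiftLinear ((Ideal.Quotient.mkₐ ℚ I).toLinearMap ∘ₗ B.d)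
    fun x hx => Ideal.Quotient.eq_zero_iff_mem.2 (hd x hx)
  d_mem := by
    rintro p _ ⟨a, ha, rfl⟩
    exact ⟨B.d a, B.d_mem p a ha, rfl⟩
  d_d := by
    intro a
    obtain ⟨a, rfl⟩ := Ideal.Quotient.mk_surjective a
    change Ideal.Quotient.mk I (B.d (B.d a)) = 0
    rw [B.d_d, map_zero]
  leibniz := by
    rintro p _ b ⟨a, ha, rfl⟩
    obtain ⟨b, rfl⟩ := Ideal.Quotient.mk_surjective b
    exact congrArg (Ideal.Quotient.mkₐ ℚ I) (B.leibniz p a b ha)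
  graded_comm := by
    rintro p q _ _ ⟨a, ha, rfl⟩ ⟨b, hb, rfl⟩
    exact congrArg (Ideal.Quotient.mkₐ ℚ I) (B.graded_comm p q a b ha hb)

/-- The projection onto the quotient. -/
noncomputable def toQuotient
    (hI : ∀ (p : ℕ) (x : B), x ∈ I → (DirectSum.decompose B.deg x p : B) ∈ I)
    (hd : ∀ x ∈ I, B.d x ∈ I) : Hom B (B.quotient I hI hd) where
  toAlgHom := Ideal.Quotient.mkₐ ℚ I
  map_deg := fun _ a ha => ⟨a, ha, rfl⟩
  map_d := fun _ => rfl

end Quotient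

section Radical

variable {B : CDGA.{u}} {n : ℕ} {ε : Module.Dual ℚ B}

/-- The radical of the pairing defined by a functional. -/
def radical (ε : Module.Dual ℚ B) : Ideal B where
  carrier := {b | ∀ x, ε (x * b) = 0}
  add_mem' := fun ha hb x => by rw [mul_add, map_add, ha x, hb x, add_zero]
  zero_mem' := fun x => by rw [mul_zero, map_zero]
  smul_mem' := fun c b hb x => by rw [smul_eq_mul, ← mul_assoc, hb]

theorem mem_radical {b : B} : b ∈ radical ε ↔ ∀ x, ε (x * b) = 0 := Iff.rfl

theorem mem_radical_of_homogeneous {b : B} (h : ∀ p, ∀ x ∈ B.deg p, ε (x * b) = 0) :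
    b ∈ radical ε :=
  LinearMap.congr_fun (f := ε ∘ₗ LinearMap.mulRight ℚ b) (g := 0) (B.ext_dual h)

/-- For `y` of degree `n - p`, `ε(y x)` sees only the component of `x` in degree `p`; for `y` of any
other degree the product has the wrong degree. -/
theorem decompose_mem_radical (hε : ε ∈ B.suspendedDual n 0) (p : ℕ) (x : B)
    (hx : x ∈ radical ε) : (DirectSum.decompose B.deg x p : B) ∈ radical ε := by
  refine mem_radical_of_homogeneous fun q y hy => ?_
  by_cases h : q + p = n
  · rw [← DirectSum.coe_decompose_mul_add_of_left_mem B.deg hy,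
      ← apply_eq_apply_decompose hε (by omega)]
    exact hx y
  · exact hε (q + p) (by omega) _ (SetLike.GradedMul.mul_mem hy (SetLike.coe_mem _))

theorem d_mem_radical (hεd : ∀ x, ε (B.d x) = 0) (x : B) (hx : x ∈ radical ε) :
    B.d x ∈ radical ε := by
  refine mem_radical_of_homogeneous fun q y hy => ?_
  have h := hεd (y * x)
  rw [B.leibniz q y x hy, map_add, hx, zero_add, map_smul, smul_eq_mul] at h
  exact (mul_eq_zero.1 h).resolve_left (pow_ne_zero _ (by norm_num))

/-- Graded commutativity swaps only homogeneous factors, which is why homogeneity of the radical is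
needed first. -/
theorem isTwoSided_radical (hε : ε ∈ B.suspendedDual n 0) : (radical ε).IsTwoSided where
  mul_mem_of_left := by
    intro a b ha
    induction b using DirectSum.Decomposition.inductionOn B.deg with
    | zero => simp
    | @homogeneous i m =>
      classical
      rw [← DirectSum.sum_support_decompose B.deg a, Finset.sum_mul]
      refine Ideal.sum_mem _ fun p _ => ?_
      rw [B.graded_comm p i _ _ (SetLike.coe_mem _) m.2]
      exact Submodule.smul_of_tower_mem _ _
        (Ideal.mul_mem_left _ _ (decompose_mem_radical hε p a ha))
    | add b c hb hc => rw [mul_add]; exact Ideal.add_mem _ hb hc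

/-- The quotient of a CDGA by the radical of a functional of degree `n` which vanishes on
coboundaries. -/
noncomputable def radicalQuotient (hε : ε ∈ B.suspendedDual n 0) (hεd : ∀ x, ε (B.d x) = 0) :
    CDGA.{u} :=
  haveI := isTwoSided_radical hε
  B.quotient (radical ε) (decompose_mem_radical hε) (d_mem_radical hεd)

/-- The projection onto the quotient by the radical. -/
noncomputable def toRadicalQuotient (hε : ε ∈ B.suspendedDual n 0) (hεd : ∀ x, ε (B.d x) = 0) :
    Hom B (radicalQuotient hε hεd) :=
  haveI := isTwoSided_radical hε
  B.toQuotient (radical ε) (decompose_mem_radical hε) (d_mem_radical hεd)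

theorem toRadicalQuotient_eq_zero_iff (hε : ε ∈ B.suspendedDual n 0) (hεd : ∀ x, ε (B.d x) = 0)
    {x : B} : (toRadicalQuotient hε hεd).toAlgHom x = 0 ↔ x ∈ radical ε :=
  haveI := isTwoSided_radical hε
  Ideal.Quotient.eq_zero_iff_mem (I := radical ε)

theorem exists_toRadicalQuotient_eq (hε : ε ∈ B.suspendedDual n 0) (hεd : ∀ x, ε (B.d x) = 0)
    (y : radicalQuotient hε hεd) : ∃ x, (toRadicalQuotient hε hεd).toAlgHom x = y :=
  haveI := isTwoSided_radical hε
  Ideal.Quotient.mk_surjective (I := radical ε) y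

theorem exists_toRadicalQuotient_eq_of_mem (hε : ε ∈ B.suspendedDual n 0)
    (hεd : ∀ x, ε (B.d x) = 0) {p : ℕ} {y : radicalQuotient hε hεd}
    (hy : y ∈ (radicalQuotient hε hεd).deg p) :
    ∃ x ∈ B.deg p, (toRadicalQuotient hε hεd).toAlgHom x = y := hy

/-- The functional induced on the quotient by the radical. -/
noncomputable def radicalQuotientFunctional (hε : ε ∈ B.suspendedDual n 0)
    (hεd : ∀ x, ε (B.d x) = 0) : Module.Dual ℚ (radicalQuotient hε hεd) :=
  haveI := isTwoSided_radical hε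
  (radical ε).quotientLiftLinear ε fun x hx => by simpa using hx 1

theorem radicalQuotientFunctional_apply (hε : ε ∈ B.suspendedDual n 0) (hεd : ∀ x, ε (B.d x) = 0)
    (x : B) :
    radicalQuotientFunctional hε hεd ((toRadicalQuotient hε hεd).toAlgHom x) = ε x := rfl

theorem isFiniteType_radicalQuotient (hε : ε ∈ B.suspendedDual n 0) (hεd : ∀ x, ε (B.d x) = 0)
    (hB : B.IsFiniteType) : (radicalQuotient hε hεd).IsFiniteType := by
  intro p
  have := hB p
  have := isTwoSided_radical hε
  change FiniteDimensional ℚ ((B.deg p).map (Ideal.Quotient.mkₐ ℚ (radical ε)).toLinearMap)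
  infer_instance

/-- A nonzero scalar in the radical would force `ε = 0`. -/
theorem isConnected_radicalQuotient (hε : ε ∈ B.suspendedDual n 0) (hεd : ∀ x, ε (B.d x) = 0)
    (hB : B.IsConnected) (h0 : ε ≠ 0) : (radicalQuotient hε hεd).IsConnected := by
  constructor
  · rw [injective_iff_map_eq_zero]
    intro r hr
    by_contra hne
    rw [← (toRadicalQuotient hε hεd).toAlgHom.commutes r, toRadicalQuotient_eq_zero_iff,
      mem_radical] at hr
    apply h0
    ext x
    have := hr x
    rw [← Algebra.commutes, ← Algebra.smul_def, map_smul, smul_eq_mul] at this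
    exact (mul_eq_zero.1 this).resolve_left hne
  · intro a ha
    obtain ⟨x, hx, rfl⟩ := exists_toRadicalQuotient_eq_of_mem hε hεd ha
    obtain ⟨r, rfl⟩ := hB.2 x hx
    exact ⟨r, ((toRadicalQuotient hε hεd).toAlgHom.commutes r).symm⟩

theorem radicalQuotientFunctional_mem (hε : ε ∈ B.suspendedDual n 0) (hεd : ∀ x, ε (B.d x) = 0) :
    radicalQuotientFunctional hε hεd ∈ (radicalQuotient hε hεd).suspendedDual n 0 := by
  intro q hq y hy
  obtain ⟨x, hx, rfl⟩ := exists_toRadicalQuotient_eq_of_mem hε hεd hy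
  exact hε q hq x hx

theorem radicalQuotientFunctional_d (hε : ε ∈ B.suspendedDual n 0) (hεd : ∀ x, ε (B.d x) = 0)
    (y : radicalQuotient hε hεd) :
    radicalQuotientFunctional hε hεd ((radicalQuotient hε hεd).d y) = 0 := by
  obtain ⟨x, rfl⟩ := exists_toRadicalQuotient_eq hε hεd y
  exact hεd x

theorem radicalQuotientFunctional_nondegenerate (hε : ε ∈ B.suspendedDual n 0)
    (hεd : ∀ x, ε (B.d x) = 0) (y : radicalQuotient hε hεd)
    (h : ∀ z, radicalQuotientFunctional hε hεd (z * y) = 0) : y = 0 := by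
  obtain ⟨x, rfl⟩ := exists_toRadicalQuotient_eq hε hεd y
  rw [toRadicalQuotient_eq_zero_iff]
  intro z
  have := h ((toRadicalQuotient hε hεd).toAlgHom z)
  rwa [← map_mul, radicalQuotientFunctional_apply] at this

/-- The quotient by the radical is isomorphic to its suspended dual. -/
noncomputable def radicalQuotientPoincareIso (hε : ε ∈ B.suspendedDual n 0)
    (hεd : ∀ x, ε (B.d x) = 0) (hB : B.IsFiniteType) : (radicalQuotient hε hεd).PoincareIso n :=
  PoincareIso.ofNondegenerate (isFiniteType_radicalQuotient hε hεd hB)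
    (radicalQuotientFunctional_mem hε hεd) (radicalQuotientFunctional_d hε hεd)
    (radicalQuotientFunctional_nondegenerate hε hεd)

theorem radicalQuotientPoincareIso_one (hε : ε ∈ B.suspendedDual n 0)
    (hεd : ∀ x, ε (B.d x) = 0) (hB : B.IsFiniteType) (x : B) :
    (radicalQuotientPoincareIso hε hεd hB).θ 1 ((toRadicalQuotient hε hεd).toAlgHom x) = ε x := by
  rw [radicalQuotientPoincareIso, PoincareIso.ofNondegenerate_apply, mul_one,
    radicalQuotientFunctional_apply]

end Radical

end CDGA

/-! ### Cohomology classes, orientations, and a criterion for quasi-isomorphisms. -/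

namespace CDGA

/-- The cohomology class of a cocycle. -/
noncomputable def cohomologyClass (A : CDGA.{u}) : A.cocycles →ₐ[ℚ] A.cohomology :=
  Ideal.Quotient.mkₐ ℚ A.coboundaries

section Class

variable {A : CDGA.{u}}

theorem exists_cohomologyClass_eq (c : A.cohomology) : ∃ z, A.cohomologyClass z = c :=
  Ideal.Quotient.mk_surjective (I := A.coboundaries) c

theorem cohomologyClass_eq_zero_iff {z : A.cocycles} :
    A.cohomologyClass z = 0 ↔ ∃ a, (z : A) = A.d a :=
  Ideal.Quotient.eq_zero_iff_mem (I := A.coboundaries)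

theorem exists_cohomologyClass_eq_of_mem {p : ℕ} {c : A.cohomology}
    (hc : c ∈ A.cohomology.deg p) :
    ∃ z : A.cocycles, (z : A) ∈ A.deg p ∧ A.cohomologyClass z = c := hc

theorem cohomologyClass_mem {p : ℕ} {z : A.cocycles} (hz : (z : A) ∈ A.deg p) :
    A.cohomologyClass z ∈ A.cohomology.deg p := ⟨z, hz, rfl⟩

/-- The orientation class of a cohomology algebra with Poincaré duality is represented by a
functional on cochains. -/
theorem exists_orientation {n : ℕ} (J : A.cohomology.PoincareIso n) :
    ∃ ε ∈ A.suspendedDual n 0, (∀ x, ε (A.d x) = 0) ∧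
      ∀ z : A.cocycles, ε z = J.θ 1 (A.cohomologyClass z) := by
  -- Any linear extension from the cocycles will do. Composing it with the projection to degree `n`
  -- makes it homogeneous and keeps its values on cocycles, since `J.θ 1` vanishes outside degree
  -- `n`.
  obtain ⟨g, hg⟩ := LinearMap.exists_extend (p := A.cocycles.toSubmodule)
    (J.θ 1 ∘ₗ A.cohomologyClass.toLinearMap)
  have hg' : ∀ z : A.cocycles, g z = J.θ 1 (A.cohomologyClass z) :=
    fun z => LinearMap.congr_fun hg z
  have key : ∀ z : A.cocycles,
      (g ∘ₗ GradedAlgebra.proj A.deg n) z = J.θ 1 (A.cohomologyClass z) := by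
    intro z
    induction z using DirectSum.Decomposition.inductionOn A.cocycleDeg with
    | zero => simp
    | @homogeneous i m =>
      have hm : ((m : A.cocycles) : A) ∈ A.deg i := m.2
      rw [LinearMap.comp_apply, GradedAlgebra.proj_apply]
      by_cases hi : i = n
      · subst hi
        rw [DirectSum.decompose_of_mem_same _ hm, hg']
      · rw [DirectSum.decompose_of_mem_ne _ hm hi, map_zero,
          J.one_mem i (by omega) _ (cohomologyClass_mem hm)]
    | add a b ha hb =>
      rw [map_add, map_add, ← ha, ← hb, ← map_add]
      rfl
  refine ⟨_, comp_proj_mem_suspendedDual (by omega) g, fun x => ?_, key⟩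
  rw [key ⟨A.d x, A.d_d x⟩, cohomologyClass_eq_zero_iff.2 ⟨x, rfl⟩, map_zero]

end Class

namespace Hom

variable {A B : CDGA.{u}} (f : Hom A B)

theorem decompose_map (p : ℕ) (a : A) :
    (DirectSum.decompose B.deg (f.toAlgHom a) p : B) =
      f.toAlgHom (DirectSum.decompose A.deg a p : A) := by
  induction a using DirectSum.Decomposition.inductionOn A.deg with
  | zero => simp
  | @homogeneous i m =>
    by_cases h : i = p
    · subst h
      rw [DirectSum.decompose_of_mem_same _ m.2,
        DirectSum.decompose_of_mem_same _ (f.map_deg i m m.2)]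
    · rw [DirectSum.decompose_of_mem_ne _ m.2 h,
        DirectSum.decompose_of_mem_ne _ (f.map_deg i m m.2) h, map_zero]
  | add a b ha hb => simp [ha, hb]

theorem map_cocycle {z : A} (hz : A.d z = 0) : B.d (f.toAlgHom z) = 0 := by
  rw [← f.map_d, hz, map_zero]

theorem mapCohomology_class (z : A.cocycles) :
    f.mapCohomology (A.cohomologyClass z) = B.cohomologyClass (f.mapCocycles z) := rfl

/-- The differential is homogeneous, so components of cocycles are cocycles and components of
coboundaries are coboundaries. -/
theorem isQuasiIso_of_homogeneous
    (hinj : ∀ p, ∀ z ∈ A.deg p, A.d z = 0 → (∃ b, f.toAlgHom z = B.d b) → ∃ a, z = A.d a)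
    (hsurj : ∀ p, ∀ w ∈ B.deg p, B.d w = 0 → ∃ z b, A.d z = 0 ∧ w = f.toAlgHom z + B.d b) :
    f.IsQuasiIso := by
  classical
  constructor
  · rw [injective_iff_map_eq_zero]
    intro c hc
    obtain ⟨z, rfl⟩ := exists_cohomologyClass_eq c
    rw [mapCohomology_class, cohomologyClass_eq_zero_iff] at hc
    obtain ⟨b, hb⟩ := hc
    change f.toAlgHom z = B.d b at hb
    have hz : A.d (z : A) = 0 := z.2
    have h : (z : A) ∈ LinearMap.range A.d := by
      rw [← DirectSum.sum_support_decompose A.deg (z : A)]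
      refine Submodule.sum_mem _ fun p _ => ?_
      obtain ⟨a, ha⟩ := hinj p (DirectSum.decompose A.deg (z : A) p : A) (SetLike.coe_mem _)
        (by rw [← decompose_d_succ, hz]; simp) (by
          rw [← decompose_map, hb]
          cases p with
          | zero => exact ⟨0, by rw [decompose_d_zero, map_zero]⟩
          | succ p => exact ⟨_, decompose_d_succ B p b⟩)
      exact ⟨a, ha.symm⟩
    obtain ⟨a, ha⟩ := h
    exact cohomologyClass_eq_zero_iff.2 ⟨a, ha.symm⟩
  · have key : ∀ w : B.cocycles, ∃ z : A.cocycles, ∃ b, (w : B) = f.toAlgHom z + B.d b := by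
      intro w
      induction w using DirectSum.Decomposition.inductionOn B.cocycleDeg with
      | zero => exact ⟨0, 0, by simp⟩
      | @homogeneous i m =>
        obtain ⟨z, b, hz, h⟩ := hsurj i (m : B.cocycles) m.2 (m : B.cocycles).2
        exact ⟨⟨z, hz⟩, b, h⟩
      | add v w hv hw =>
        obtain ⟨y, a, hy⟩ := hv
        obtain ⟨z, b, hz⟩ := hw
        refine ⟨y + z, a + b, ?_⟩
        change (v : B) + w = f.toAlgHom (y + z) + _
        rw [map_add, map_add, hy, hz]
        abel
    intro c
    obtain ⟨w, rfl⟩ := exists_cohomologyClass_eq c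
    obtain ⟨z, b, h⟩ := key w
    refine ⟨A.cohomologyClass z, ?_⟩
    rw [mapCohomology_class, ← sub_eq_zero, ← map_sub, cohomologyClass_eq_zero_iff]
    refine ⟨-b, ?_⟩
    change f.toAlgHom z - w = _
    rw [h, map_neg]
    abel

variable {f} {n : ℕ}

/-- A morphism that is compatible with Poincaré dualities is a quasi-isomorphism if it is
surjective in cohomology up to the middle dimension. -/
theorem isQuasiIso_of_surjective_below (I : B.PoincareIso n) (J : A.cohomology.PoincareIso n)
    (hIJ : ∀ z : A.cocycles, I.θ 1 (f.toAlgHom z) = J.θ 1 (A.cohomologyClass z))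
    (hlow : ∀ p, 2 * p ≤ n → ∀ w ∈ B.deg p, B.d w = 0 →
      ∃ z b, A.d z = 0 ∧ w = f.toAlgHom z + B.d b) : f.IsQuasiIso := by
  refine f.isQuasiIso_of_homogeneous ?_ ?_
  · rintro p z hz hdz ⟨b, hb⟩
    -- Injectivity needs no degree bound: if `f z` is a coboundary, the class of `z` pairs to zero
    -- with all of `H(A)`.
    refine cohomologyClass_eq_zero_iff.1 ((J.bijOn p).injOn
      (cohomologyClass_mem (z := ⟨z, hdz⟩) hz) (Submodule.zero_mem _) ?_)
    rw [map_zero]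
    ext c
    obtain ⟨y, rfl⟩ := exists_cohomologyClass_eq c
    rw [J.apply_eq, ← map_mul, ← hIJ]
    change I.θ 1 (f.toAlgHom (y * z)) = 0
    obtain ⟨c, hc⟩ := B.cocycle_mul_d _ b (f.map_cocycle y.2)
    rw [map_mul, hb, hc, I.apply_one_d]
  · intro p u hu hdu
    rcases Nat.lt_or_ge n p with hp | hp
    · exact ⟨0, 0, map_zero _, by rw [I.eq_zero_of_lt hp hu]; simp⟩
    by_cases hpn : 2 * p ≤ n
    · exact hlow p hpn u hu hdu
    obtain ⟨q, hq⟩ : ∃ q, q + p = n := ⟨n - p, by omega⟩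
    -- Above the middle degree, pairing with `u` is a functional on `H(A)`. Duality represents it by
    -- a class `z`, the candidate preimage of the class of `u`.
    let φ : Module.Dual ℚ A.cohomology := A.coboundaries.quotientLiftLinear
      (I.θ 1 ∘ₗ LinearMap.mulRight ℚ u ∘ₗ f.toAlgHom.toLinearMap ∘ₗ A.cocycles.val.toLinearMap) (by
        rintro z ⟨a, ha⟩
        change I.θ 1 (f.toAlgHom z * u) = 0
        rw [ha, f.map_d, ← B.d_mul_of_cocycle _ _ hdu, I.apply_one_d])
    have hφ : ∀ y : A.cocycles, φ (A.cohomologyClass y) = I.θ 1 (f.toAlgHom y * u) := fun y => rfl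
    have hφm : φ ∈ A.cohomology.suspendedDual n p := by
      intro r hr c hc
      obtain ⟨y, hy, rfl⟩ := exists_cohomologyClass_eq_of_mem hc
      rw [hφ]
      exact I.one_mem (r + p) (by omega) _ (SetLike.GradedMul.mul_mem (f.map_deg r y hy) hu)
    obtain ⟨c, hc, hcφ⟩ := (J.bijOn p).surjOn hφm
    obtain ⟨z, hz, rfl⟩ := exists_cohomologyClass_eq_of_mem hc
    have hdz : A.d (z : A) = 0 := z.2
    have hzy : ∀ y : A, A.d y = 0 → I.θ 1 (f.toAlgHom y * (u - f.toAlgHom z)) = 0 := by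
      intro y hy
      have h1 := LinearMap.congr_fun hcφ (A.cohomologyClass ⟨y, hy⟩)
      rw [J.apply_eq, ← map_mul, ← hIJ, hφ] at h1
      rw [mul_sub, map_sub, ← map_mul, ← h1]
      exact sub_self _
    set v := u - f.toAlgHom z with hv
    have hvm : v ∈ B.deg p := Submodule.sub_mem _ hu (f.map_deg p z hz)
    have hdv : B.d v = 0 := by rw [hv, map_sub, hdu, f.map_cocycle hdz, sub_zero]
    have hθv := (I.bijOn p).mapsTo hvm
    -- The error `v` is orthogonal to the image of the cocycles of `A`. In the complementary degree
    -- `q`, which is below the middle, these exhaust the cocycles of `B` up to coboundaries.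
    have hker : ∀ x, B.d x = 0 → I.θ v x = 0 := by
      intro x hx
      rw [apply_eq_apply_decompose hθv hq]
      obtain ⟨y, b, hy, h⟩ := hlow q (by omega) (DirectSum.decompose B.deg x q : B)
        (SetLike.coe_mem _) (by rw [← decompose_d_succ, hx]; simp)
      rw [h, map_add, I.apply_eq v, I.apply_eq v, hzy y hy, ← B.d_mul_of_cocycle _ _ hdv,
        I.apply_one_d, add_zero]
    -- A functional that kills cocycles factors through `d`. Duality in `B` turns the factor into an
    -- element `b` with `d b = ± v`.
    obtain ⟨g, hg⟩ := B.d.exists_eq_comp_of_ker_le (I.θ v) hker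
    obtain ⟨r, rfl⟩ : ∃ r, p = r + 1 := ⟨p - 1, by omega⟩
    obtain ⟨b, hb, hbg⟩ := (I.bijOn r).surjOn
      (comp_proj_mem_suspendedDual (q := q + 1) (n := n) (by omega) g)
    have hdb : I.θ (B.d b) = (-1 : ℚ) ^ (n + r) • I.θ v := by
      rw [I.map_d r b hb, hbg]
      refine B.ext_dual fun i x hx => ?_
      change (-1 : ℚ) ^ (n + r) • g (GradedAlgebra.proj B.deg (q + 1) (B.d x)) =
        (-1 : ℚ) ^ (n + r) • I.θ v x
      rw [GradedAlgebra.proj_apply, decompose_d_succ, hg, ← apply_eq_apply_decompose hθv hq]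
    have hvb : v = B.d ((-1 : ℚ) ^ (n + r) • b) := by
      refine (I.bijOn (r + 1)).injOn hvm (B.d_mem r _ (Submodule.smul_mem _ _ hb)) ?_
      rw [map_smul, map_smul, hdb, smul_smul, ← mul_pow]
      simp
    exact ⟨z, _, hdz, by rw [← hvb, hv]; abel⟩

end Hom

end CDGA

/-- The maps `π p` read off the components of a sum, which gives independence. -/
theorem DirectSum.isInternal_of_projections {K M : Type*} [Field K] [AddCommGroup M] [Module K M]
    (V : ℕ → Submodule K M) (π : ℕ → M →ₗ[K] M) (h_same : ∀ p, ∀ x ∈ V p, π p x = x)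
    (h_ne : ∀ p q, q ≠ p → ∀ x ∈ V q, π p x = 0) (h_top : ∀ x, x ∈ ⨆ p, V p) :
    DirectSum.IsInternal V := by
  classical
  constructor
  · have key : ∀ p, π p ∘ₗ DirectSum.coeLinearMap V =
        (V p).subtype ∘ₗ DirectSum.component K ℕ (fun p => V p) p := by
      refine fun p => DirectSum.linearMap_ext K fun q => LinearMap.ext fun x => ?_
      simp only [LinearMap.comp_apply, DirectSum.coeLinearMap_lof]
      by_cases h : q = p
      · subst h
        rw [h_same q x x.2, DirectSum.component.lof_self]
        rfl
      · rw [h_ne p q h x x.2, DirectSum.component.of, dif_neg h, map_zero]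
    rw [injective_iff_map_eq_zero]
    intro v hv
    refine DirectSum.ext_component K fun p => Subtype.ext ?_
    have h : π p (DirectSum.coeLinearMap V v) = (v p : M) := LinearMap.congr_fun (key p) v
    rw [show DirectSum.coeLinearMap V v = 0 from hv, map_zero] at h
    exact h.symm
  · intro x
    have h := h_top x
    rw [← DirectSum.range_coeLinearMap] at h
    exact h

/-! ### The square-zero extension by the suspended dual of `A/N`. -/

namespace CDGA

/-- A homogeneous differential ideal which contains all elements of degree greater than `n`. -/
structure BoundedDGIdeal (A : CDGA.{u}) (n : ℕ) where
  /-- The underlying subspace. -/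
  carrier : Submodule ℚ A
  mul_mem_left : ∀ a x : A, x ∈ carrier → a * x ∈ carrier
  mul_mem_right : ∀ a x : A, x ∈ carrier → x * a ∈ carrier
  d_mem : ∀ x ∈ carrier, A.d x ∈ carrier
  decompose_mem : ∀ (p : ℕ), ∀ x ∈ carrier, (DirectSum.decompose A.deg x p : A) ∈ carrier
  deg_le : ∀ p, n < p → A.deg p ≤ carrier

namespace BoundedDGIdeal

variable {A : CDGA.{u}} {n : ℕ} (N : BoundedDGIdeal A n)

theorem scale_mem (c : ℚ) {x : A} (hx : x ∈ N.carrier) : A.scale c x ∈ N.carrier := by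
  classical
  rw [← DirectSum.sum_support_decompose A.deg x, map_sum]
  refine Submodule.sum_mem _ fun p _ => ?_
  rw [scale_of_mem c (SetLike.coe_mem _)]
  exact Submodule.smul_mem _ _ (N.decompose_mem p x hx)

/-- The functionals that vanish on the ideal. -/
def DualModule : Type u := N.carrier.dualAnnihilator

namespace DualModule

noncomputable instance : AddCommGroup N.DualModule :=
  inferInstanceAs (AddCommGroup N.carrier.dualAnnihilator)

noncomputable instance : Module ℚ N.DualModule :=
  inferInstanceAs (Module ℚ N.carrier.dualAnnihilator)

variable {N}

/-- A functional on the quotient as a functional on the algebra. -/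
def toDual : N.DualModule →ₗ[ℚ] Module.Dual ℚ A := N.carrier.dualAnnihilator.subtype

/-- A functional that vanishes on the ideal. -/
def mk (f : Module.Dual ℚ A) (hf : ∀ x ∈ N.carrier, f x = 0) : N.DualModule :=
  ⟨f, (Submodule.mem_dualAnnihilator _).2 hf⟩

@[simp]
theorem toDual_mk (f : Module.Dual ℚ A) (hf : ∀ x ∈ N.carrier, f x = 0) : toDual (mk f hf) = f :=
  rfl

theorem toDual_injective : Function.Injective (toDual (N := N)) := Subtype.val_injective

theorem ext {f g : N.DualModule} (h : ∀ x, toDual f x = toDual g x) : f = g :=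
  toDual_injective (LinearMap.ext h)

theorem ext_homogeneous {f g : N.DualModule}
    (h : ∀ p, ∀ x ∈ A.deg p, toDual f x = toDual g x) : f = g :=
  toDual_injective (A.ext_dual h)

theorem toDual_apply_of_mem (f : N.DualModule) {x : A} (hx : x ∈ N.carrier) : toDual f x = 0 :=
  (Submodule.mem_dualAnnihilator _).1 f.2 x hx

noncomputable instance : Module A N.DualModule where
  smul a f := mk (toDual f ∘ₗ LinearMap.mulRight ℚ a)
    fun x hx => f.toDual_apply_of_mem (N.mul_mem_right a x hx)
  one_smul f := ext fun x => congrArg (toDual f) (mul_one x)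
  mul_smul a b f := ext fun x => congrArg (toDual f) (mul_assoc x a b).symm
  smul_zero _ := rfl
  smul_add _ _ _ := rfl
  add_smul a b f := ext fun x => (congrArg (toDual f) (mul_add x a b)).trans (map_add _ _ _)
  zero_smul f := ext fun x => (congrArg (toDual f) (mul_zero x)).trans (map_zero _)

/-- The twist by `(-1)^(n+1)` in each degree produces the Koszul sign relating the two actions
(`op_smul_eq`). As `scale` is an algebra morphism, the formula makes sense without homogeneity. -/
noncomputable instance : Module Aᵐᵒᵖ N.DualModule where
  smul a f := mk (toDual f ∘ₗ LinearMap.mulLeft ℚ (A.scale ((-1) ^ (n + 1)) a.unop))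
    fun x hx => f.toDual_apply_of_mem (N.mul_mem_left _ x hx)
  one_smul f := ext fun x => congrArg (toDual f) (by simp)
  mul_smul a b f := ext fun x => congrArg (toDual f) (by simp)
  smul_zero _ := rfl
  smul_add _ _ _ := rfl
  add_smul a b f := ext fun x => by
    change toDual f (A.scale _ (a.unop + b.unop) * x) = toDual f (A.scale _ a.unop * x) +
      toDual f (A.scale _ b.unop * x)
    rw [map_add, add_mul, map_add]
  zero_smul f := ext fun x => by
    change toDual f (A.scale _ 0 * x) = 0
    simp

@[simp]
theorem toDual_smul (a : A) (f : N.DualModule) (x : A) : toDual (a • f) x = toDual f (x * a) := rfl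

@[simp]
theorem toDual_op_smul (a : A) (f : N.DualModule) (x : A) :
    toDual (MulOpposite.op a • f) x = toDual f (A.scale ((-1) ^ (n + 1)) a * x) := rfl

instance : SMulCommClass A Aᵐᵒᵖ N.DualModule where
  smul_comm _ _ f := ext fun _ => congrArg (toDual f) (mul_assoc _ _ _).symm

instance : IsScalarTower ℚ A N.DualModule where
  smul_assoc r a f := ext fun x => by
    change toDual f (x * r • a) = r • toDual f (x * a)
    rw [mul_smul_comm, map_smul]

instance : IsScalarTower ℚ Aᵐᵒᵖ N.DualModule where
  smul_assoc r a f := ext fun x => by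
    change toDual f (A.scale _ (r • a.unop) * x) = r • toDual f (A.scale _ a.unop * x)
    rw [map_smul, smul_mul_assoc, map_smul]

/-- The homogeneous components. -/
noncomputable def _root_.CDGA.BoundedDGIdeal.dualDeg (N : BoundedDGIdeal A n) (p : ℕ) :
    Submodule ℚ N.DualModule :=
  (A.suspendedDual n p).comap toDual

/-- The differential. -/
noncomputable def _root_.CDGA.BoundedDGIdeal.dualD (N : BoundedDGIdeal A n) :
    N.DualModule →ₗ[ℚ] N.DualModule where
  toFun f := mk (toDual f ∘ₗ (A.scale (-1)).toLinearMap ∘ₗ A.d)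
    fun _ hx => f.toDual_apply_of_mem (N.scale_mem _ (N.d_mem _ hx))
  map_add' _ _ := rfl
  map_smul' _ _ := rfl

@[simp]
theorem toDual_d (f : N.DualModule) (x : A) :
    toDual (N.dualD f) x = toDual f (A.scale (-1) (A.d x)) :=
  rfl

/-- If `f` has degree `p`, the value can be nonzero only for `q + 1 + p = n`, and there the sign
equals the `(-1)^(n+p)` of `dualDifferential`. -/
theorem toDual_d_of_mem (f : N.DualModule) {q : ℕ} {x : A} (hx : x ∈ A.deg q) :
    toDual (N.dualD f) x = (-1 : ℚ) ^ (q + 1) * toDual f (A.d x) := by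
  rw [toDual_d, scale_of_mem _ (A.d_mem q x hx), map_smul, smul_eq_mul]

theorem d_mem {p : ℕ} {f : N.DualModule} (hf : f ∈ N.dualDeg p) :
    N.dualD f ∈ N.dualDeg (p + 1) := by
  intro q hq x hx
  rw [toDual_d_of_mem f hx, hf (q + 1) (by omega) _ (A.d_mem q x hx), mul_zero]

theorem d_d (f : N.DualModule) : N.dualD (N.dualD f) = 0 := by
  refine ext_homogeneous fun q x hx => ?_
  rw [toDual_d_of_mem _ hx, toDual_d_of_mem _ (A.d_mem q x hx), A.d_d]
  simp

theorem smul_mem {p q : ℕ} {a : A} (ha : a ∈ A.deg p) {f : N.DualModule} (hf : f ∈ N.dualDeg q) :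
    a • f ∈ N.dualDeg (p + q) := by
  intro r hr x hx
  rw [toDual_smul]
  exact hf (r + p) (by omega) _ (SetLike.GradedMul.mul_mem hx ha)

theorem op_smul_eq {p q : ℕ} {a : A} (ha : a ∈ A.deg p) {f : N.DualModule} (hf : f ∈ N.dualDeg q) :
    MulOpposite.op a • f = (-1 : ℚ) ^ (p * q) • a • f := by
  refine ext_homogeneous fun r x hx => ?_
  rw [map_smul toDual ((-1 : ℚ) ^ (p * q)), LinearMap.smul_apply, toDual_smul, toDual_op_smul,
    scale_of_mem _ ha, smul_mul_assoc, map_smul]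
  by_cases hr : r + p + q = n
  · rw [A.graded_comm p r a x ha hx, map_smul, smul_smul, ← pow_mul, ← pow_add]
    congr 1
    -- The three terms are the twist, the commutation of `a` with `x`, and the desired Koszul sign.
    -- They cancel modulo `2` because `n = r + p + q` and `p(p+1)` is even.
    have h : Even ((n + 1) * p + p * r + p * q) := by
      rw [← hr,
        show (r + p + q + 1) * p + p * r + p * q = p * (p + 1) + 2 * (p * r + p * q) by ring]
      exact (Nat.even_mul_succ_self p).add (even_two_mul _)
    rw [← mul_left_inj' (pow_ne_zero (p * q) (neg_ne_zero.2 (one_ne_zero (α := ℚ)))), ← pow_add,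
      ← pow_add, h.neg_one_pow, ← two_mul, (even_two_mul _).neg_one_pow]
  · rw [hf (p + r) (by omega) _ (SetLike.GradedMul.mul_mem ha hx),
      hf (r + p) (by omega) _ (SetLike.GradedMul.mul_mem hx ha), smul_zero, smul_zero]

theorem d_smul {p : ℕ} {a : A} (ha : a ∈ A.deg p) (f : N.DualModule) :
    N.dualD (a • f) = A.d a • f + (-1 : ℚ) ^ p • a • N.dualD f := by
  refine ext_homogeneous fun q x hx => ?_
  rw [toDual_d_of_mem _ hx, map_add, map_smul toDual ((-1 : ℚ) ^ p), LinearMap.add_apply,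
    LinearMap.smul_apply, toDual_smul, toDual_smul, toDual_smul,
    toDual_d_of_mem f (SetLike.GradedMul.mul_mem hx ha), A.leibniz q x a hx, map_add, map_smul,
    smul_eq_mul, smul_eq_mul]
  have h1 : (-1 : ℚ) ^ p * (-1) ^ p = 1 := by rw [← mul_pow]; simp
  have h2 : (-1 : ℚ) ^ q * (-1) ^ q = 1 := by rw [← mul_pow]; simp
  simp only [pow_add, pow_one]
  linear_combination ((-1) ^ q * toDual f (A.d x * a) + toDual f (x * A.d a) *
    ((-1) ^ q * (-1) ^ q)) * h1 + toDual f (x * A.d a) * h2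

theorem d_op_smul (a : A) {q : ℕ} {f : N.DualModule} (hf : f ∈ N.dualDeg q) :
    N.dualD (MulOpposite.op a • f) =
      MulOpposite.op a • N.dualD f + (-1 : ℚ) ^ q • MulOpposite.op (A.d a) • f := by
  induction a using DirectSum.Decomposition.inductionOn A.deg with
  | zero => simp
  | @homogeneous p m =>
    rw [op_smul_eq m.2 hf, op_smul_eq m.2 (DualModule.d_mem hf),
      op_smul_eq (A.d_mem p m m.2) hf, map_smul, d_smul m.2, smul_add, smul_smul, smul_smul,
      ← pow_add, ← pow_add, add_comm, show p * q + p = p * (q + 1) by ring,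
      show q + (p + 1) * q = p * q + 2 * q by ring, pow_add _ (p * q), pow_mul _ 2]
    simp
  | add a b ha hb =>
    rw [MulOpposite.op_add, add_smul, map_add, ha, hb, map_add, MulOpposite.op_add, add_smul,
      add_smul, smul_add]
    abel

theorem finiteDimensional_deg (hA : A.IsFiniteType) (p : ℕ) :
    FiniteDimensional ℚ (N.dualDeg p) := by
  have := finiteDimensional_suspendedDual hA n p
  exact FiniteDimensional.of_injective
    (toDual.restrict (p := N.dualDeg p) (q := A.suspendedDual n p) fun _ h => h)
    fun f g h => Subtype.ext (toDual_injective (Subtype.ext_iff.1 h :))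

/-- The degree `p` part is the dual of `(A/N)^(n-p)`. For `p > n` the condition is vacuous. -/
theorem eq_zero_of_mem_deg {p : ℕ} (h : ∀ q, q + p = n → A.deg q ≤ N.carrier) {f : N.DualModule}
    (hf : f ∈ N.dualDeg p) : f = 0 := by
  refine ext_homogeneous fun q x hx => ?_
  rw [map_zero, LinearMap.zero_apply]
  by_cases hq : q + p = n
  · exact f.toDual_apply_of_mem (h q hq hx)
  · exact hf q hq x hx

/-- The projection onto the component of degree `n - q`. -/
noncomputable def _root_.CDGA.BoundedDGIdeal.projDual (N : BoundedDGIdeal A n) (q : ℕ) :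
    N.DualModule →ₗ[ℚ] N.DualModule where
  toFun f := mk (toDual f ∘ₗ GradedAlgebra.proj A.deg q)
    fun x hx => f.toDual_apply_of_mem (N.decompose_mem q x hx)
  map_add' _ _ := rfl
  map_smul' _ _ := rfl

theorem toDual_projDual (q : ℕ) (f : N.DualModule) (x : A) :
    toDual (N.projDual q f) x = toDual f (DirectSum.decompose A.deg x q : A) := rfl

theorem projDual_mem {p q : ℕ} (h : q + p = n) (f : N.DualModule) : N.projDual q f ∈ N.dualDeg p :=
  comp_proj_mem_suspendedDual h _

theorem projDual_of_mem {p q : ℕ} (h : q + p = n) {f : N.DualModule} (hf : f ∈ N.dualDeg p) :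
    N.projDual q f = f :=
  ext fun x => (apply_eq_apply_decompose hf h x).symm

theorem projDual_of_mem_ne {p q : ℕ} (h : q + p ≠ n) {f : N.DualModule} (hf : f ∈ N.dualDeg p) :
    N.projDual q f = 0 :=
  ext fun _ => hf q h _ (SetLike.coe_mem _)

/-- This is where `N` must contain all degrees above `n`: it makes the full dual of `A/N` a finite
sum of homogeneous parts. -/
theorem sum_projDual (f : N.DualModule) :
    ∑ p ∈ Finset.range (n + 1), N.projDual (n - p) f = f := by
  refine ext_homogeneous fun q x hx => ?_
  rw [map_sum, LinearMap.sum_apply]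
  rcases Nat.lt_or_ge n q with h | h
  · rw [f.toDual_apply_of_mem (N.deg_le q h hx)]
    refine Finset.sum_eq_zero fun p hp => ?_
    rw [toDual_projDual, DirectSum.decompose_of_mem_ne _ hx (by omega), map_zero]
  · rw [Finset.sum_eq_single (n - q)]
    · rw [toDual_projDual, show n - (n - q) = q by omega, DirectSum.decompose_of_mem_same _ hx]
    · intro p hp hpq
      rw [Finset.mem_range] at hp
      rw [toDual_projDual, DirectSum.decompose_of_mem_ne _ hx (by omega), map_zero]
    · intro h'
      rw [Finset.mem_range] at h'
      omega

end DualModule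

open DualModule TrivSqZeroExt

/-- The homogeneous components of the square-zero extension. -/
noncomputable def extensionDeg (p : ℕ) : Submodule ℚ (TrivSqZeroExt A N.DualModule) :=
  Submodule.prod (A.deg p) (N.dualDeg p)

theorem mem_extensionDeg_iff {p : ℕ} {x : TrivSqZeroExt A N.DualModule} :
    x ∈ N.extensionDeg p ↔ x.fst ∈ A.deg p ∧ x.snd ∈ N.dualDeg p := Iff.rfl

instance : SetLike.GradedMonoid N.extensionDeg where
  one_mem := ⟨SetLike.GradedOne.one_mem, Submodule.zero_mem _⟩
  mul_mem := by
    intro p q x y hx hy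
    obtain ⟨hx, hx'⟩ := N.mem_extensionDeg_iff.1 hx
    obtain ⟨hy, hy'⟩ := N.mem_extensionDeg_iff.1 hy
    refine ⟨SetLike.GradedMul.mul_mem hx hy, ?_⟩
    change x.fst • y.snd + MulOpposite.op y.fst • x.snd ∈ N.dualDeg (p + q)
    refine Submodule.add_mem _ (DualModule.smul_mem hx hy') ?_
    rw [op_smul_eq hy hx', add_comm p q]
    exact Submodule.smul_mem _ _ (DualModule.smul_mem hy hx')

theorem isInternal_extensionDeg : DirectSum.IsInternal N.extensionDeg := by
  classical
  refine DirectSum.isInternal_of_projections N.extensionDeg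
    (fun p => LinearMap.prodMap (GradedAlgebra.proj A.deg p)
      -- For `p > n` the truncated difference `n - p` would be `0` and select the wrong component.
      (if p ≤ n then N.projDual (n - p) else 0)) ?_ ?_ ?_
  · rintro p x ⟨hx, hx'⟩
    refine TrivSqZeroExt.ext (DirectSum.decompose_of_mem_same _ hx) ?_
    change (if p ≤ n then N.projDual (n - p) else 0) x.snd = x.snd
    split_ifs with h
    · exact projDual_of_mem (by omega) hx'
    · exact (eq_zero_of_mem_deg (fun q hq => by omega) hx').symm
  · rintro p q hpq x ⟨hx, hx'⟩
    refine TrivSqZeroExt.ext (DirectSum.decompose_of_mem_ne _ hx hpq) ?_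
    change (if p ≤ n then N.projDual (n - p) else 0) x.snd = 0
    split_ifs with h
    · exact projDual_of_mem_ne (by omega) hx'
    · rfl
  · intro x
    rw [← TrivSqZeroExt.inl_fst_add_inr_snd_eq x]
    refine Submodule.add_mem _ ?_ ?_
    · rw [← DirectSum.sum_support_decompose A.deg x.fst, TrivSqZeroExt.inl_sum]
      exact Submodule.sum_mem _ fun p _ => Submodule.mem_iSup_of_mem p
        ⟨SetLike.coe_mem _, Submodule.zero_mem _⟩
    · rw [← sum_projDual x.snd, TrivSqZeroExt.inr_sum]
      refine Submodule.sum_mem _ fun p hp => Submodule.mem_iSup_of_mem p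
        ⟨Submodule.zero_mem _, projDual_mem ?_ _⟩
      rw [Finset.mem_range] at hp
      omega

noncomputable instance : GradedAlgebra N.extensionDeg where
  toDecomposition := N.isInternal_extensionDeg.chooseDecomposition

/-- The square-zero extension of a CDGA by the suspended dual of a quotient. -/
noncomputable def extension : CDGA.{u} where
  carrier := TrivSqZeroExt A N.DualModule
  deg := N.extensionDeg
  d := LinearMap.prodMap A.d N.dualD
  d_mem := fun p x hx => ⟨A.d_mem p _ hx.1, DualModule.d_mem hx.2⟩
  d_d := fun x => TrivSqZeroExt.ext (A.d_d _) (DualModule.d_d _)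
  leibniz := by
    intro p x y hx
    obtain ⟨hx, hx'⟩ := N.mem_extensionDeg_iff.1 hx
    refine TrivSqZeroExt.ext (A.leibniz p _ _ hx) ?_
    change N.dualD (x.fst • y.snd + MulOpposite.op y.fst • x.snd) =
      A.d x.fst • y.snd + MulOpposite.op y.fst • N.dualD x.snd +
      (-1 : ℚ) ^ p • (x.fst • N.dualD y.snd + MulOpposite.op (A.d y.fst) • x.snd)
    rw [map_add, d_smul hx, d_op_smul _ hx', smul_add]
    abel
  graded_comm := by
    intro p q x y hx hy
    obtain ⟨hx, hx'⟩ := N.mem_extensionDeg_iff.1 hx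
    obtain ⟨hy, hy'⟩ := N.mem_extensionDeg_iff.1 hy
    refine TrivSqZeroExt.ext (A.graded_comm p q _ _ hx hy) ?_
    change x.fst • y.snd + MulOpposite.op y.fst • x.snd =
      (-1 : ℚ) ^ (p * q) • (y.fst • x.snd + MulOpposite.op x.fst • y.snd)
    rw [op_smul_eq hy hx', op_smul_eq hx hy', smul_add, smul_smul, ← mul_pow, mul_comm q p]
    simp [add_comm]

/-- The inclusion of the algebra in the square-zero extension. -/
noncomputable def toExtension : Hom A N.extension where
  toAlgHom := TrivSqZeroExt.inlAlgHom ℚ A N.DualModule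
  map_deg := fun _ _ ha => ⟨ha, Submodule.zero_mem _⟩
  map_d := fun _ => TrivSqZeroExt.ext rfl (map_zero N.dualD).symm

theorem isFiniteType_extension (hA : A.IsFiniteType) : N.extension.IsFiniteType := by
  intro p
  have := hA p
  have := DualModule.finiteDimensional_deg (N := N) hA p
  change FiniteDimensional ℚ (Submodule.prod (A.deg p) (N.dualDeg p))
  exact Module.Finite.iff_fg.2 (Submodule.FG.prod (Module.Finite.iff_fg.1 inferInstance)
    (Module.Finite.iff_fg.1 inferInstance))

/-- The new summand in degree `0` is the dual of `(A/N)^n`, which vanishes. -/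
theorem isConnected_extension (hA : A.IsConnected) (hN : A.deg n ≤ N.carrier) :
    N.extension.IsConnected := by
  constructor
  · intro r s h
    exact hA.1 (congrArg TrivSqZeroExt.fst h)
  · rintro x ⟨hx, hx'⟩
    obtain ⟨r, hr⟩ := hA.2 _ hx
    refine ⟨r, TrivSqZeroExt.ext hr ?_⟩
    refine (eq_zero_of_mem_deg (fun q hq => ?_) hx').symm
    obtain rfl : q = n := by omega
    exact hN

/-- The first component. -/
noncomputable def fst : N.extension →ₗ[ℚ] A := LinearMap.fst ℚ A N.DualModule

/-- The second component. -/
noncomputable def snd : N.extension →ₗ[ℚ] N.DualModule := LinearMap.snd ℚ A N.DualModule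

/-- An element of the extension given by its components. -/
def pair (a : A) (f : N.DualModule) : N.extension := (a, f)

@[simp]
theorem fst_pair (a : A) (f : N.DualModule) : N.fst (N.pair a f) = a := rfl

@[simp]
theorem snd_pair (a : A) (f : N.DualModule) : N.snd (N.pair a f) = f := rfl

variable {N}

theorem extension_ext {x y : N.extension} (h : N.fst x = N.fst y) (h' : N.snd x = N.snd y) :
    x = y := TrivSqZeroExt.ext h h'

theorem mem_deg_extension_iff {p : ℕ} {x : N.extension} :
    x ∈ N.extension.deg p ↔ N.fst x ∈ A.deg p ∧ N.snd x ∈ N.dualDeg p := Iff.rfl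

@[simp]
theorem fst_d (x : N.extension) : N.fst (N.extension.d x) = A.d (N.fst x) := rfl

@[simp]
theorem snd_d (x : N.extension) : N.snd (N.extension.d x) = N.dualD (N.snd x) := rfl

@[simp]
theorem fst_toExtension (a : A) : N.fst (N.toExtension.toAlgHom a) = a := rfl

@[simp]
theorem snd_toExtension (a : A) : N.snd (N.toExtension.toAlgHom a) = 0 := rfl

@[simp]
theorem fst_mul (x y : N.extension) : N.fst (x * y) = N.fst x * N.fst y := rfl

@[simp]
theorem snd_mul (x y : N.extension) :
    N.snd (x * y) = N.fst x • N.snd y + MulOpposite.op (N.fst y) • N.snd x := rfl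

variable (N)

/-- The extension of a functional by evaluation at `1`. -/
noncomputable def extensionFunctional (ε : Module.Dual ℚ A) : Module.Dual ℚ N.extension :=
  ε ∘ₗ N.fst + LinearMap.applyₗ 1 ∘ₗ toDual ∘ₗ N.snd

variable {ε : Module.Dual ℚ A}

theorem extensionFunctional_apply (x : N.extension) :
    N.extensionFunctional ε x = ε (N.fst x) + toDual (N.snd x) 1 := rfl

theorem extensionFunctional_mem (hε : ε ∈ A.suspendedDual n 0) :
    N.extensionFunctional ε ∈ N.extension.suspendedDual n 0 := by
  intro q hq x hx
  obtain ⟨hx, hx'⟩ := mem_deg_extension_iff.1 hx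
  rw [extensionFunctional_apply, hε q hq _ hx, zero_add]
  exact hx' 0 (by omega) 1 SetLike.GradedOne.one_mem

theorem extensionFunctional_d (hεd : ∀ x, ε (A.d x) = 0) (x : N.extension) :
    N.extensionFunctional ε (N.extension.d x) = 0 := by
  rw [extensionFunctional_apply, fst_d, snd_d, hεd, toDual_d, A.d_one, map_zero, map_zero, add_zero]

theorem extensionFunctional_mul (x y : N.extension) :
    N.extensionFunctional ε (x * y) = ε (N.fst x * N.fst y) + toDual (N.snd y) (N.fst x) +
      toDual (N.snd x) (A.scale ((-1) ^ (n + 1)) (N.fst y)) := by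
  rw [extensionFunctional_apply, fst_mul, snd_mul, map_add, LinearMap.add_apply, toDual_smul,
    toDual_op_smul, one_mul, mul_one, add_assoc]

end BoundedDGIdeal
end CDGA

theorem Submodule.exists_complement_le {K M : Type*} [Field K] [AddCommGroup M] [Module K M]
    {V W : Submodule K M} (h : V ≤ W) : ∃ X ≤ W, Disjoint X V ∧ V ⊔ X = W := by
  obtain ⟨C, hC⟩ := V.exists_isCompl
  refine ⟨C ⊓ W, inf_le_right, hC.disjoint.symm.mono_left inf_le_left, ?_⟩
  rw [← sup_inf_assoc_of_le C h, hC.sup_eq_top, top_inf_eq]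

namespace CDGA

theorem scale_scale {A : CDGA.{u}} {c : ℚ} (hc : c * c = 1) (x : A) :
    A.scale c (A.scale c x) = x := by
  induction x using DirectSum.Decomposition.inductionOn A.deg with
  | zero => simp
  | @homogeneous p m =>
    rw [scale_of_mem c m.2, map_smul, scale_of_mem c m.2, smul_smul, ← mul_pow, hc, one_pow,
      one_smul]
  | add a b ha hb => rw [map_add, map_add, ha, hb]

/-- The composition of morphisms of CDGAs. -/
def Hom.comp {A B C : CDGA.{u}} (g : Hom B C) (f : Hom A B) : Hom A C where
  toAlgHom := g.toAlgHom.comp f.toAlgHom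
  map_deg := fun p _ ha => g.map_deg p _ (f.map_deg p _ ha)
  map_d := fun a => (congrArg g.toAlgHom (f.map_d a)).trans (g.map_d _)

namespace BoundedDGIdeal

open DualModule

/-! ### The radical of the extended functional, and acyclicity of the dual summand. -/

section Radical

variable {A : CDGA.{u}} {n : ℕ} {N : BoundedDGIdeal A n} {ε : Module.Dual ℚ A}

/-- Test the radical condition against `(a, 0)`. -/
theorem snd_apply_of_mem_radical {x : N.extension} (hx : x ∈ radical (N.extensionFunctional ε))
    (a : A) : toDual (N.snd x) a = -ε (a * N.fst x) := by
  have h := hx (N.pair a 0)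
  rw [extensionFunctional_mul, fst_pair, snd_pair, map_zero, LinearMap.zero_apply, add_zero,
    add_comm] at h
  exact eq_neg_of_add_eq_zero_left h

/-- Testing against `(0, φ)` shows that every `φ` vanishing on `N` kills the first component, up to
a sign twist that preserves `N`. A subspace is the common kernel of the functionals that vanish on
it. -/
theorem fst_mem_of_mem_radical {x : N.extension} (hx : x ∈ radical (N.extensionFunctional ε)) :
    N.fst x ∈ N.carrier := by
  rw [← scale_scale (c := (-1) ^ (n + 1)) (by rw [← mul_pow]; simp) (N.fst x)]
  refine N.scale_mem _ ?_
  rw [← Subspace.dualAnnihilator_dualCoannihilator_eq (W := N.carrier),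
    Submodule.mem_dualCoannihilator]
  intro φ hφ
  have h := hx (N.pair 0 (DualModule.mk φ ((Submodule.mem_dualAnnihilator _).1 hφ)))
  rw [extensionFunctional_mul, fst_pair, snd_pair, zero_mul, map_zero, map_zero, zero_add,
    zero_add] at h
  exact h

/-- The condition on `N` says that `A/N` has no cohomology in degree `q`. Dualizing over a field
preserves exactness, so the dual has none in degree `p = n - q`. -/
theorem exists_dualD_eq {p q : ℕ} (hq : q + p = n)
    (hN : ∀ a ∈ A.deg q, A.d a ∈ N.carrier → ∃ y ∈ N.carrier, ∃ b, a = y + A.d b)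
    {f : N.DualModule} (hf : f ∈ N.dualDeg p) (hdf : N.dualD f = 0) :
    ∃ g, N.dualD g = f := by
  have hfd : ∀ b, toDual f (A.d b) = 0 := by
    refine LinearMap.congr_fun (f := toDual f ∘ₗ A.d) (g := 0) (A.ext_dual fun r b hb => ?_)
    have h := toDual_d_of_mem f hb
    rw [hdf, map_zero, LinearMap.zero_apply] at h
    exact (mul_eq_zero.1 h.symm).resolve_left (pow_ne_zero _ (by norm_num))
  have hker : ∀ a, (N.carrier.mkQ ∘ₗ A.d) a = 0 → toDual f a = 0 := by
    intro a ha
    rw [LinearMap.comp_apply, Submodule.mkQ_apply, Submodule.Quotient.mk_eq_zero] at ha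
    rw [apply_eq_apply_decompose hf hq]
    obtain ⟨y, hy, b, h⟩ := hN (DirectSum.decompose A.deg a q : A) (SetLike.coe_mem _) (by
      rw [← decompose_d_succ]
      exact N.decompose_mem _ _ ha)
    rw [h, map_add, f.toDual_apply_of_mem hy, hfd, add_zero]
  obtain ⟨φ, hφ⟩ := (N.carrier.mkQ ∘ₗ A.d).exists_eq_comp_of_ker_le (toDual f) hker
  -- The extra `scale (-1)` cancels the one in the definition of `dualD`.
  refine ⟨DualModule.mk (φ ∘ₗ N.carrier.mkQ ∘ₗ (A.scale (-1)).toLinearMap) fun x hx => ?_,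
    DualModule.ext fun a => ?_⟩
  · change φ (Submodule.Quotient.mk (A.scale (-1) x)) = 0
    rw [(Submodule.Quotient.mk_eq_zero _).2 (N.scale_mem _ hx), map_zero]
  · rw [toDual_d, toDual_mk, ← hφ]
    change φ (N.carrier.mkQ (A.scale (-1) (A.scale (-1) (A.d a)))) = _
    rw [scale_scale (by norm_num)]
    rfl

end Radical

/-! ### The choice of the ideal `N`. -/

section OfComponents

variable {A : CDGA.{u}} {n : ℕ}

/-- The ideal with given homogeneous components. -/
noncomputable def ofComponents (V : ℕ → Submodule ℚ A)
    (hmul : ∀ p q, ∀ a ∈ A.deg p, ∀ x ∈ V q, a * x ∈ V (p + q))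
    (hd : ∀ p, ∀ x ∈ V p, A.d x ∈ V (p + 1)) (htop : ∀ p, n < p → A.deg p ≤ V p) :
    BoundedDGIdeal A n :=
  let S : Submodule ℚ A := ⨅ p, (V p).comap (GradedAlgebra.proj A.deg p)
  have mem_iff : ∀ x, x ∈ S ↔ ∀ p, (DirectSum.decompose A.deg x p : A) ∈ V p := by
    intro x
    simp only [S, Submodule.mem_iInf, Submodule.mem_comap, GradedAlgebra.proj_apply]
  have mem_of : ∀ p, ∀ x ∈ A.deg p, x ∈ V p → x ∈ S := by
    intro p x hx hxV
    rw [mem_iff]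
    intro q
    by_cases h : p = q
    · subst h
      rwa [DirectSum.decompose_of_mem_same _ hx]
    · rw [DirectSum.decompose_of_mem_ne _ hx h]
      exact Submodule.zero_mem _
  have hdec : ∀ (p : ℕ), ∀ x ∈ S, (DirectSum.decompose A.deg x p : A) ∈ S :=
    fun p x hx => mem_of p _ (SetLike.coe_mem _) ((mem_iff x).1 hx p)
  have hleft : ∀ a x : A, x ∈ S → a * x ∈ S := by
    intro a x hx
    induction a using DirectSum.Decomposition.inductionOn A.deg with
    | zero => rw [zero_mul]; exact Submodule.zero_mem _
    | @homogeneous i m =>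
      rw [mem_iff] at hx ⊢
      intro r
      by_cases h : i ≤ r
      · rw [DirectSum.coe_decompose_mul_of_left_mem_of_le A.deg m.2 h]
        have := hmul i (r - i) m m.2 _ (hx (r - i))
        rwa [Nat.add_sub_cancel' h] at this
      · rw [DirectSum.coe_decompose_mul_of_left_mem_of_not_le A.deg m.2 h]
        exact Submodule.zero_mem _
    | add a b ha hb => rw [add_mul]; exact Submodule.add_mem _ ha hb
  { carrier := S
    mul_mem_left := hleft
    mul_mem_right := by
      classical
      intro a x hx
      induction a using DirectSum.Decomposition.inductionOn A.deg with
      | zero => rw [mul_zero]; exact Submodule.zero_mem _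
      | @homogeneous i m =>
        rw [← DirectSum.sum_support_decompose A.deg x, Finset.sum_mul]
        refine Submodule.sum_mem _ fun p _ => ?_
        rw [A.graded_comm p i _ _ (SetLike.coe_mem _) m.2]
        exact Submodule.smul_mem _ _ (hleft _ _ (hdec p x hx))
      | add a b ha hb => rw [mul_add]; exact Submodule.add_mem _ ha hb
    d_mem := by
      intro x hx
      rw [mem_iff] at hx ⊢
      rintro (_ | p)
      · rw [decompose_d_zero]
        exact Submodule.zero_mem _
      · rw [decompose_d_succ]
        exact hd p _ (hx p)
    decompose_mem := hdec
    deg_le := fun p hp x hx => mem_of p x hx (htop p hp hx) }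

theorem mem_ofComponents_iff (V : ℕ → Submodule ℚ A)
    (hmul : ∀ p q, ∀ a ∈ A.deg p, ∀ x ∈ V q, a * x ∈ V (p + q))
    (hd : ∀ p, ∀ x ∈ V p, A.d x ∈ V (p + 1)) (htop : ∀ p, n < p → A.deg p ≤ V p)
    {p : ℕ} {x : A} (hx : x ∈ A.deg p) :
    x ∈ (ofComponents V hmul hd htop).carrier ↔ x ∈ V p := by
  change x ∈ (⨅ p, (V p).comap (GradedAlgebra.proj A.deg p) : Submodule ℚ A) ↔ _
  simp only [Submodule.mem_iInf, Submodule.mem_comap, GradedAlgebra.proj_apply]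
  refine ⟨fun h => ?_, fun h q => ?_⟩
  · have := h p
    rwa [DirectSum.decompose_of_mem_same _ hx] at this
  · by_cases hq : p = q
    · subst hq
      rwa [DirectSum.decompose_of_mem_same _ hx]
    · rw [DirectSum.decompose_of_mem_ne _ hx hq]
      exact Submodule.zero_mem _

end OfComponents

/-- A differential ideal that is zero below the middle dimension, everything above it, and a
complement of the coboundaries in between. -/
theorem exists_complementary {A : CDGA.{u}} {n : ℕ} (hA : A.IsOneConnected) (hn : 3 ≤ n) :
    ∃ N : BoundedDGIdeal A n,
      (∀ p, 2 * p < n → ∀ a ∈ A.deg p, a ∈ N.carrier → a = 0) ∧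
      (∀ p, n + 2 < 2 * p → A.deg p ≤ N.carrier) ∧
      (∀ p, 2 * p ≤ n → ∀ a ∈ A.deg p, A.d a ∈ N.carrier → A.d a = 0) ∧
      (∀ q, n ≤ 2 * q → ∀ a ∈ A.deg q, A.d a ∈ N.carrier →
        ∃ y ∈ N.carrier, ∃ b, a = y + A.d b) := by
  have hX := fun p => Submodule.exists_complement_le
    (inf_le_right : LinearMap.range A.d ⊓ A.deg p ≤ A.deg p)
  have hY := fun p => Submodule.exists_complement_le
    (show LinearMap.range A.d ⊓ A.deg p ≤ LinearMap.ker A.d ⊓ A.deg p by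
      refine inf_le_inf_right _ ?_
      rintro _ ⟨a, rfl⟩
      exact A.d_d a)
  choose X hXle hXd hXs using hX
  choose Y hYle hYd hYs using hY
  -- `X p` complements the coboundaries in all of `A^p`. In the exact middle `Y p` complements them
  -- only inside the cocycles, so that `d` kills it: `V (p + 1)` is then just `X (p + 1)`, which
  -- contains no nonzero coboundary.
  let V : ℕ → Submodule ℚ A := fun p =>
    if 2 * p < n then ⊥ else if 2 * p = n then Y p else if 2 * p ≤ n + 2 then X p else A.deg p
  have V_low : ∀ p, 2 * p < n → V p = ⊥ := fun p h => if_pos h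
  have V_mid : ∀ p, 2 * p = n → V p = Y p := fun p h => by
    simp only [V]; rw [if_neg (by omega), if_pos h]
  have V_next : ∀ p, n < 2 * p → 2 * p ≤ n + 2 → V p = X p := fun p h h' => by
    simp only [V]; rw [if_neg (by omega), if_neg (by omega), if_pos h']
  have V_top : ∀ p, n + 2 < 2 * p → V p = A.deg p := fun p h => by
    simp only [V]; rw [if_neg (by omega), if_neg (by omega), if_neg (by omega)]
  have V_le : ∀ p, V p ≤ A.deg p := by
    intro p
    simp only [V]
    split_ifs
    exacts [bot_le, (hYle p).trans inf_le_right, hXle p, le_rfl]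
  have V_d : ∀ p, 2 * p ≤ n → ∀ a ∈ A.deg p, A.d a ∈ V (p + 1) → A.d a = 0 := by
    intro p hp a ha h
    have hB : A.d a ∈ LinearMap.range A.d ⊓ A.deg (p + 1) := ⟨⟨a, rfl⟩, A.d_mem p a ha⟩
    rcases lt_trichotomy (2 * (p + 1)) n with h' | h' | h'
    · rw [V_low _ h'] at h
      exact (Submodule.mem_bot ℚ).1 h
    · rw [V_mid _ h'] at h
      exact Submodule.disjoint_def.1 (hYd _) _ h hB
    · rw [V_next _ h' (by omega)] at h
      exact Submodule.disjoint_def.1 (hXd _) _ h hB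
  have hmul : ∀ p q, ∀ a ∈ A.deg p, ∀ x ∈ V q, a * x ∈ V (p + q) := by
    intro p q a ha x hx
    rcases Nat.lt_or_ge (2 * q) n with hq | hq
    · rw [V_low q hq, Submodule.mem_bot] at hx
      rw [hx, mul_zero]
      exact Submodule.zero_mem _
    · match p, ha with
      | 0, ha =>
        obtain ⟨r, rfl⟩ := hA.1.2 a ha
        rw [← Algebra.smul_def, zero_add]
        exact Submodule.smul_mem _ _ hx
      | 1, ha =>
        rw [hA.2, Submodule.mem_bot] at ha
        rw [ha, zero_mul]
        exact Submodule.zero_mem _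
      -- With `A^1 = 0`, nonscalar multiplication raises the degree by at least two and so jumps
      -- from `≥ n/2` past `n/2 + 1`.
      | p + 2, ha =>
        rw [V_top _ (by omega)]
        exact SetLike.GradedMul.mul_mem ha (V_le q hx)
  have hd : ∀ p, ∀ x ∈ V p, A.d x ∈ V (p + 1) := by
    intro p x hx
    rcases lt_trichotomy (2 * p) n with h | h | h
    · rw [V_low p h, Submodule.mem_bot] at hx
      rw [hx, map_zero]
      exact Submodule.zero_mem _
    · rw [V_mid p h] at hx
      rw [show A.d x = 0 from (hYle p hx).1]
      exact Submodule.zero_mem _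
    · rw [V_top _ (by omega)]
      exact A.d_mem p x (V_le p hx)
  have htop : ∀ p, n < p → A.deg p ≤ V p := fun p hp => (V_top p (by omega)).ge
  have mem_iff : ∀ {p : ℕ} {x : A}, x ∈ A.deg p →
      (x ∈ (ofComponents V hmul hd htop).carrier ↔ x ∈ V p) :=
    fun hx => mem_ofComponents_iff V hmul hd htop hx
  refine ⟨ofComponents V hmul hd htop, fun p hp a ha h => ?_, fun p hp a ha => ?_,
    fun p hp a ha h => ?_, fun q hq a ha h => ?_⟩
  · rw [mem_iff ha, V_low p hp] at h
    exact (Submodule.mem_bot ℚ).1 h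
  · rw [mem_iff ha, V_top p hp]
    exact ha
  · exact V_d p hp a ha ((mem_iff (A.d_mem p a ha)).1 h)
  · rcases hq.eq_or_lt with hq | hq
    -- In the exact middle, a cocycle modulo `N` is already a cocycle, hence splits along `Y q`.
    · have h0 := V_d q hq.ge a ha ((mem_iff (A.d_mem q a ha)).1 h)
      have hmem : a ∈ LinearMap.ker A.d ⊓ A.deg q := ⟨h0, ha⟩
      rw [← hYs q, Submodule.mem_sup] at hmem
      obtain ⟨_, ⟨⟨b, rfl⟩, -⟩, y, hy, rfl⟩ := hmem
      exact ⟨y, (mem_iff (hYle q hy).2).2 (by rwa [V_mid q hq.symm]), b, add_comm _ _⟩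
    · by_cases hq' : 2 * q ≤ n + 2
      · have hmem := ha
        rw [← hXs q, Submodule.mem_sup] at hmem
        obtain ⟨_, ⟨⟨b, rfl⟩, -⟩, y, hy, rfl⟩ := hmem
        exact ⟨y, (mem_iff (hXle q hy)).2 (by rwa [V_next q hq hq']), b, add_comm _ _⟩
      · refine ⟨a, (mem_iff ha).2 (by rwa [V_top q (by omega)]), 0, by simp⟩

end BoundedDGIdeal

/-! ### Construction of the Poincaré duality model. -/

open BoundedDGIdeal in
/-- A `1`-connected CDGA of finite type whose cohomology has Poincaré duality in dimension `n ≥ 3`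
is quasi-isomorphic to a Poincaré duality CDGA, by an isomorphism in low degrees. -/
theorem exists_poincareDuality_model {n : ℕ} (hn : 3 ≤ n) {A : CDGA.{u}}
    (hPD : A.cohomology.IsPoincareDuality n)
    (h1 : A.IsOneConnected) (hft : A.IsFiniteType) :
    ∃ (P : CDGA.{u}) (f : CDGA.Hom A P),
      P.IsPoincareDuality n ∧ f.IsQuasiIso ∧
      ∀ p : ℕ, (p : ℚ) < (n : ℚ) / 2 - 1 → f.IsIsoInDegree p := by
  obtain ⟨hHc, -, ⟨J⟩⟩ := hPD
  obtain ⟨ε, hε, hεd, hεJ⟩ := exists_orientation J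
  obtain ⟨N, hlow, htop, hNd, hN⟩ := exists_complementary h1 hn
  have hε' := N.extensionFunctional_mem hε
  have hεd' := N.extensionFunctional_d hεd
  have hBft := N.isFiniteType_extension hft
  have hext : ∀ a, N.extensionFunctional ε (N.toExtension.toAlgHom a) = ε a := fun a => by
    rw [extensionFunctional_apply, fst_toExtension, snd_toExtension, map_zero,
      LinearMap.zero_apply, add_zero]
  -- Otherwise the orientation of `H(A)` would vanish, and duality would give `1 = 0` there.
  have h0 : N.extensionFunctional ε ≠ 0 := by
    intro h
    have hJ : J.θ 1 = 0 := by
      ext c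
      obtain ⟨z, rfl⟩ := exists_cohomologyClass_eq c
      rw [← hεJ, ← hext, h]
      rfl
    have h10 : (1 : A.cohomology) = 0 := (J.bijOn 0).injOn SetLike.GradedOne.one_mem
      (Submodule.zero_mem _) (by rw [hJ, map_zero])
    refine one_ne_zero (α := ℚ) (hHc.1 ?_)
    rw [map_one, map_zero, h10]
  let π := toRadicalQuotient hε' hεd'
  let I := radicalQuotientPoincareIso hε' hεd' hBft
  refine ⟨radicalQuotient hε' hεd', π.comp N.toExtension,
    ⟨isConnected_radicalQuotient hε' hεd' (N.isConnected_extension h1.1 (htop n (by omega))) h0,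
      isFiniteType_radicalQuotient hε' hεd' hBft, ⟨I⟩⟩, ?_, ?_⟩
  · refine Hom.isQuasiIso_of_surjective_below I J (fun z => ?_) fun p hp w hw hdw => ?_
    · exact (radicalQuotientPoincareIso_one hε' hεd' hBft _).trans ((hext z).trans (hεJ z))
    · obtain ⟨x, hx, rfl⟩ := exists_toRadicalQuotient_eq_of_mem hε' hεd' hw
      obtain ⟨hx1, hx2⟩ := mem_deg_extension_iff.1 hx
      rw [← Hom.map_d, toRadicalQuotient_eq_zero_iff] at hdw
      -- A cocycle of the quotient lifts to a true cocycle `x` of the extension: `d x` lies in the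
      -- radical, so its first component is a coboundary in `N`, hence zero, and the second
      -- component is determined by the first.
      have hd0 : A.d (N.fst x) = 0 := hNd p hp _ hx1 (fst_mem_of_mem_radical hdw)
      have hd1 : N.dualD (N.snd x) = 0 := DualModule.ext fun a => by
        rw [← snd_d, snd_apply_of_mem_radical hdw, fst_d, hd0, mul_zero, map_zero, neg_zero,
          map_zero, LinearMap.zero_apply]
      obtain ⟨g, hg⟩ := exists_dualD_eq (q := n - p) (by omega) (hN (n - p) (by omega)) hx2 hd1
      refine ⟨N.fst x, π.toAlgHom (N.pair 0 g), hd0, ?_⟩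
      have hx' : x = N.toExtension.toAlgHom (N.fst x) + N.extension.d (N.pair 0 g) := by
        apply extension_ext
        · rw [map_add, fst_toExtension, fst_d, fst_pair, map_zero, add_zero]
        · rw [map_add, snd_toExtension, snd_d, snd_pair, hg, zero_add]
      rw [← Hom.map_d]
      exact (congrArg π.toAlgHom hx').trans (map_add π.toAlgHom _ _)
  · intro p hp
    -- Equivalently `2(n - p) > n + 2`: the dual summand vanishes in degree `p`, while `N` itself is
    -- zero there.
    have hp' : 2 * p + 2 < n := by
      have : (2 * p + 2 : ℚ) < n := by linarith
      exact_mod_cast this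
    refine ⟨fun a ha => Hom.map_deg _ p a ha, fun a ha b hb hab => ?_, fun w hw => ?_⟩
    · refine sub_eq_zero.1 (hlow p (by omega) _ (Submodule.sub_mem _ ha hb) ?_)
      rw [← sub_eq_zero, ← map_sub] at hab
      exact fst_mem_of_mem_radical ((toRadicalQuotient_eq_zero_iff hε' hεd').1 hab)
    · obtain ⟨x, hx, rfl⟩ := exists_toRadicalQuotient_eq_of_mem hε' hεd' hw
      obtain ⟨hx1, hx2⟩ := mem_deg_extension_iff.1 hx
      refine ⟨N.fst x, hx1, congrArg π.toAlgHom (extension_ext rfl ?_)⟩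
      exact (DualModule.eq_zero_of_mem_deg (fun q hq => htop q (by omega)) hx2).symm

end CDGA

theorem propositionP (n : ℕ) (hn : 7 ≤ n) (A : CDGA.{u})
    (hPD : A.cohomology.IsPoincareDuality n)
    (h1 : A.IsOneConnected) (hft : A.IsFiniteType)
    (hd : ∀ a ∈ A.deg 2, A.d a = 0) :
    ∃ (P : CDGA.{u}) (f : CDGA.Hom A P),
      P.IsPoincareDuality n ∧ f.IsQuasiIso ∧
      ∀ p : ℕ, (p : ℚ) < (n : ℚ) / 2 - 1 → f.IsIsoInDegree p := by
  exact CDGA.exists_poincareDuality_model (by omega) hPD h1 hft
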